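/- Let $0<\lambda<1$ and let $S^1=\{z\in\mathbb C:|z|=1\}$. Let $(a_n)_{n\ge 0}\subset S^1$ be a greedy $\lambda$-energy sequence, i.e. $a_0=1$ and, for every $n\ge 1$, $$\sum_{k=0}^{n-1}|a_n-a_k|^\lambda=\max_{x\in S^1}\sum_{k=0}^{n-1}|x-a_k|^\lambda .$$ For $N\ge 2$ let $\alpha_N=(a_0,\dots,a_{N-1})$ and $H_\lambda(\alpha_N)=\sum_{0\le i\ne j\le N-1}|a_i-a_j|^\lambda$ (sum over ordered pairs). Let $\sigma_1$ be the normalized arc length measure on $S^1$ and $I_\lambda(\sigma_1)=\iint_{S^1\times S^1}|x-y|^\lambda\,d\sigma_1(x)\,d\sigma_1(y)$. For $p\ge 1$ let $\Theta_p$ be the set of all vectors $\vec\theta=(\theta_1,\dots,\theta_p)$ for which there is an infinite sequence $\mathcal N$ of integers $N=2^{n_1}+\cdots+2^{n_p}$, $n_1>\cdots>n_p\ge 0$ (with $n_i$ depending on $N$), such that $\lim_{N\in\mathcal N}2^{n_i}/N=\theta_i$ for all $i=1,\dots,p$. For $\vec\theta\in\Theta_p$ put $$G(\vec\theta;\lambda)=\sum_{k=1}^{p}\theta_k^{-\lambda}\Big(2(2^{-\lambda}-1)\sum_{j=k+1}^{p}\theta_j+\theta_k\Big),$$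 where the $k$-th term is understood to be $0$ if $\theta_k=0$, and let $$\overline g(\lambda)=\sup_{p\ge 1}\ \sup_{\vec\theta\in\Theta_p}G(\vec\theta;\lambda).$$ Let $\zeta$ denote the Riemann zeta function. Then $\overline g(\lambda)$ is finite, the sequence $$\left(\frac{H_\lambda(\alpha_N)-N^2 I_\lambda(\sigma_1)}{N^{1-\lambda}}\right)_{N=2}^{\infty}$$ is bounded and divergent, and $$\limsup_{N\to\infty}\frac{H_\lambda(\alpha_N)-N^2 I_\lambda(\sigma_1)}{N^{1-\lambda}}=(2\pi)^\lambda\,2\zeta(-\lambda),\qquad \liminf_{N\to\infty}\frac{H_\lambda(\alpha_N)-N^2 I_\lambda(\sigma_1)}{N^{1-\lambda}}=\overline g(\lambda)\,(2\pi)^\lambda\,2\zeta(-\lambda).$$ Moreover, for every $p\ge 1$ and $\vec\theta\in\Theta_p$, the value $G(\vec\theta;\lambda)\,(2\pi)^\lambda\,2\zeta(-\lambda)$ is a limit point of this sequence, i.e. the limit of some subsequence. -/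

import Mathlib

open Filter Topology MeasureTheory

noncomputable section

namespace GreedyCircle

/-! The unit circle `S^1 = {z ∈ ℂ : |z| = 1}` is Mathlib's `Circle`; it carries its Borel
sigma-algebra, and distances are Euclidean (chordal) distances in `ℂ = ℝ^2`. -/

instance instMeasurableSpaceCircle : MeasurableSpace Circle := borel Circle

instance instBorelSpaceCircle : BorelSpace Circle := ⟨rfl⟩

/-- The `lam`-energy `H_lam(ω) = ∑_{i ≠ j} |y_i - y_j|^lam` of a configuration
`ω = (y_0, …, y_{N-1})` of `N` points on the unit circle (sum over ordered pairs). -/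
def energy (lam : ℝ) {N : ℕ} (ω : Fin N → Circle) : ℝ :=
  ∑ i, ∑ j ∈ Finset.univ.erase i, ‖(ω i : ℂ) - (ω j : ℂ)‖ ^ lam

/-- The discrete potential `U_n(x) = ∑_{k < n} |x - a_k|^lam`. -/
def potential (lam : ℝ) (a : ℕ → Circle) (n : ℕ) (x : Circle) : ℝ :=
  ∑ k ∈ Finset.range n, ‖(x : ℂ) - (a k : ℂ)‖ ^ lam

/-- `(a_n)` is a greedy `lam`-energy sequence on the unit circle, with initial point `a_0 = 1`:
for every `n ≥ 1`, the potential `U_n` attains its maximum over the circle at `a_n`. -/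
structure IsGreedy (lam : ℝ) (a : ℕ → Circle) : Prop where
  init : a 0 = 1
  greedy : ∀ n, 1 ≤ n → ∀ x : Circle, potential lam a n x ≤ potential lam a n (a n)

/-- The `N`-th section `α_N = (a_0, …, a_{N-1})` of a sequence. -/
def firstPoints (a : ℕ → Circle) (N : ℕ) : Fin N → Circle := fun i => a i

/-- The continuous `lam`-energy `I_lam(μ) = ∬ |x - y|^lam dμ(x) dμ(y)`. -/
def contEnergy (lam : ℝ) (μ : Measure Circle) : ℝ :=
  ∫ x, ∫ y, ‖(x : ℂ) - (y : ℂ)‖ ^ lam ∂μ ∂μ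

/-- The normalized uniform (arc length) measure `σ_1` on the unit circle: the image of
`dt / (2π)` on `(0, 2π]` under `t ↦ exp(i t)`. -/
def sigma1 : Measure Circle :=
  (ENNReal.ofReal (2 * Real.pi))⁻¹ •
    (volume.restrict (Set.Ioc 0 (2 * Real.pi))).map Circle.exp

/-- The normalized second order term `(H_lam(α_N) - N^2 I_lam(σ_1)) / N^(1 - lam)`. -/
def secondOrder (lam : ℝ) (a : ℕ → Circle) (N : ℕ) : ℝ :=
  (energy lam (firstPoints a N) - (N : ℝ) ^ 2 * contEnergy lam sigma1) / (N : ℝ) ^ (1 - lam)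

/-- The integer `2^{n_1} + ⋯ + 2^{n_p}`. -/
def binSum {p : ℕ} (n : Fin p → ℕ) : ℕ := ∑ i, 2 ^ n i

/-- `Θ_p`: all vectors `(θ_1, …, θ_p)` for which there is an infinite (strictly increasing)
sequence of integers `N = 2^{n_1} + ⋯ + 2^{n_p}`, `n_1 > ⋯ > n_p ≥ 0`, along which
`2^{n_i} / N → θ_i` for every `i`. -/
def Theta (p : ℕ) : Set (Fin p → ℝ) :=
  {θ | ∃ n : ℕ → Fin p → ℕ,
    (∀ m, StrictAnti (n m)) ∧
    StrictMono (fun m => binSum (n m)) ∧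
    ∀ i, Tendsto (fun m => (2 : ℝ) ^ n m i / (binSum (n m) : ℝ)) atTop (𝓝 (θ i))}

/-- `G(θ; lam) = ∑_k θ_k^{-lam} (2 (2^{-lam} - 1) ∑_{j > k} θ_j + θ_k)`, where the `k`-th term is
understood to be zero if `θ_k = 0`. -/
def G {p : ℕ} (θ : Fin p → ℝ) (lam : ℝ) : ℝ :=
  ∑ k, if θ k = 0 then 0 else
    θ k ^ (-lam) * (2 * ((2 : ℝ) ^ (-lam) - 1) * (∑ j ∈ Finset.Ioi k, θ j) + θ k)

/-- `ḡ_p(lam) = sup_{θ ∈ Θ_p} G(θ; lam)`. -/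
def gBarP (p : ℕ) (lam : ℝ) : ℝ := sSup ((fun θ => G θ lam) '' Theta p)

/-- `ḡ(lam) = sup_{p ≥ 1} ḡ_p(lam)`. -/
def gBar (lam : ℝ) : ℝ := ⨆ p : ℕ+, gBarP p lam

/-- The Riemann zeta function at a real argument, as a real number. -/
def zetaReal (s : ℝ) : ℝ := (riemannZeta (s : ℂ)).re

/-- Taking the real part loses nothing. -/
theorem ofReal_zetaReal (s : ℝ) : (zetaReal s : ℂ) = riemannZeta (s : ℂ) := by
  have h := riemannZeta_conj (s : ℂ)
  rw [Complex.conj_ofReal] at h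
  exact Complex.conj_eq_iff_re.mp h.symm

end GreedyCircle

end

open GreedyCircle

noncomputable section

namespace GreedyCircle

/-! ### Sums of powers of chord lengths over rotated roots of unity -/

/-! Write `M = 2^q`. The potential of the `M`-th roots of unity is maximal exactly at the midpoints
between neighbouring roots, that is, where `z^M = -1`. Suppose the first `M` greedy points are these
roots. The potential of the first `M + i` points is then the root potential plus that of the last
`i` points. Rotated to start at `1`, those last points again form a greedy section, and by induction
the next maximizer of their own potential is an `M`-th root of unity. Rotated back it satisfies `z^M
= -1`, so both summands can be maximal at once, and the greedy choice must maximize both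
(`HasRootSections.shiftRotate`). Hence dyadic sections are complete sets of roots of unity, and the
energy of a section of length `N` splits exactly along the binary digits of `N`
(`sectionEnergy_binSum`).

Let `L(M)` be the potential of the `M`-th roots at one of them and `R(M) = M^lam (L(M) - M I)`.
Subtracting `N^2 I` digit by digit gives the formula of `G` at the vector `2^{n_k} / N`, with values
of `R` in place of a constant factor (`secondOrder_binSum`). Fourier expansion of `|2 sin t|^lam`,
whose coefficients behave like a constant times `n^(-1 - lam)`, and the functional equation of zeta
give `R(M) → c = (2π)^lam 2ζ(-lam) < 0`. The weights decay geometrically in the digit position, so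
the second order term is `c G + o(1)`, uniformly in the number of digits
(`exists_abs_secondOrder_sub_le`).

What remains is the range of `G`. It is bounded, and it passes to the limits defining `Theta`. It is
at least `1` on binary vectors by a concavity inequality (`rpow_binSum_le`), equals `1` at `(1)`,
and exceeds `1` at `(2/3, 1/3)`. Since `c < 0`, the minimum of `G` gives the upper limit and its
supremum the lower one. -/

theorem norm_exp_sub_exp (s t : ℝ) :
    ‖(Circle.exp s : ℂ) - (Circle.exp t : ℂ)‖ = |2 * Real.sin ((s - t) / 2)| := by
  have h : (Circle.exp s : ℂ) - (Circle.exp t : ℂ)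
      = (Circle.exp t : ℂ) * (Complex.exp (Complex.I * ((s - t : ℝ) : ℂ)) - 1) := by
    rw [mul_sub, mul_one, Circle.coe_exp, Circle.coe_exp, ← Complex.exp_add]
    congr 2
    push_cast
    ring
  rw [h, norm_mul, Circle.norm_coe, one_mul, Complex.norm_exp_I_mul_ofReal_sub_one, Real.norm_eq_abs]

/-- The `lam`-potential of the `M`-th roots of unity at the point `exp (2 i x)`. -/
def rootPotential (lam : ℝ) (M : ℕ) (x : ℝ) : ℝ :=
  ∑ k ∈ Finset.range M, |2 * Real.sin (x + Real.pi * k / M)| ^ lam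

theorem abs_two_mul_sin_add_pi (x : ℝ) : |2 * Real.sin (x + Real.pi)| = |2 * Real.sin x| := by
  rw [Real.sin_add_pi, mul_neg, abs_neg]

theorem rootPotential_periodic (lam : ℝ) {M : ℕ} (hM : 0 < M) :
    Function.Periodic (rootPotential lam M) (Real.pi / M) := by
  intro x
  have hM' : (M : ℝ) ≠ 0 := by positivity
  have h1 : rootPotential lam M (x + Real.pi / M)
      = ∑ k ∈ Finset.range M, |2 * Real.sin (x + Real.pi * ((k + 1 : ℕ) : ℝ) / M)| ^ lam := by
    refine Finset.sum_congr rfl fun k _ => ?_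
    congr 4
    push_cast
    ring
  have h2 := Finset.sum_range_succ (fun k : ℕ => |2 * Real.sin (x + Real.pi * k / M)| ^ lam) M
  rw [Finset.sum_range_succ'] at h2
  have h3 : x + Real.pi * M / M = x + Real.pi := by field_simp
  simp only [h3, abs_two_mul_sin_add_pi, Nat.cast_zero, mul_zero, zero_div, add_zero] at h2
  rw [h1]
  exact add_right_cancel h2

theorem rootPotential_neg (lam : ℝ) {M : ℕ} (hM : 0 < M) (x : ℝ) :
    rootPotential lam M (-x) = rootPotential lam M x := by
  have hM' : (M : ℝ) ≠ 0 := by positivity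
  rw [← rootPotential_periodic lam hM x, rootPotential, rootPotential, ← Finset.sum_range_reflect]
  refine Finset.sum_congr rfl fun k hk => ?_
  have hk' := Finset.mem_range.mp hk
  have hc : ((M - 1 - k : ℕ) : ℝ) = M - 1 - k := by
    rw [Nat.cast_sub (by omega), Nat.cast_sub (by omega), Nat.cast_one]
  have : -x + Real.pi * ((M - 1 - k : ℕ) : ℝ) / M
      = -(x + Real.pi / M + Real.pi * k / M) + Real.pi := by
    rw [hc]; field_simp; ring
  rw [this, abs_two_mul_sin_add_pi, Real.sin_neg, mul_neg, abs_neg]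

/-- The power is concave and strictly increasing. Strictness comes from the sine alone, so `lam = 1`
is allowed. -/
theorem abs_sin_rpow_add_lt {lam : ℝ} (h0 : 0 < lam) (h1 : lam ≤ 1) {s t : ℝ}
    (hs : s ∈ Set.Icc 0 Real.pi) (ht : t ∈ Set.Icc 0 Real.pi) (hst : s ≠ t) :
    |2 * Real.sin s| ^ lam + |2 * Real.sin t| ^ lam < 2 * |2 * Real.sin ((s + t) / 2)| ^ lam := by
  have hsin := strictConcaveOn_sin_Icc.2 hs ht hst (show (0 : ℝ) < 1 / 2 by norm_num)
    (show (0 : ℝ) < 1 / 2 by norm_num) (by norm_num)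
  simp only [smul_eq_mul] at hsin
  have hs0 := Real.sin_nonneg_of_mem_Icc hs
  have ht0 := Real.sin_nonneg_of_mem_Icc ht
  have hmid : (1 / 2 * s + 1 / 2 * t) = (s + t) / 2 := by ring
  rw [hmid] at hsin
  have hm0 : 0 ≤ Real.sin ((s + t) / 2) := by linarith
  rw [abs_of_nonneg (by positivity), abs_of_nonneg (by positivity), abs_of_nonneg (by positivity)]
  have hc := (Real.concaveOn_rpow h0.le h1).2
    (show 2 * Real.sin s ∈ Set.Ici 0 by simpa using hs0)
    (show 2 * Real.sin t ∈ Set.Ici 0 by simpa using ht0) (show (0 : ℝ) ≤ 1 / 2 by norm_num)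
    (show (0 : ℝ) ≤ 1 / 2 by norm_num) (by norm_num)
  simp only [smul_eq_mul] at hc
  have hlt := Real.rpow_lt_rpow (by positivity)
    (show 1 / 2 * (2 * Real.sin s) + 1 / 2 * (2 * Real.sin t) < 2 * Real.sin ((s + t) / 2) by
      linarith) h0
  linarith

/-- Average `x` with its mirror image `π/M - x`, which has the same potential. All arguments stay in
`[0, π]`, so strict midpoint concavity applies to each summand. -/
theorem rootPotential_lt {lam : ℝ} (h0 : 0 < lam) (h1 : lam ≤ 1) {M : ℕ} (hM : 0 < M) {x : ℝ}
    (hx0 : 0 ≤ x) (hx1 : x ≤ Real.pi / M) (hx : x ≠ Real.pi / (2 * M)) :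
    rootPotential lam M x < rootPotential lam M (Real.pi / (2 * M)) := by
  have hM' : (0 : ℝ) < M := by positivity
  have hsymm : rootPotential lam M (Real.pi / M - x) = rootPotential lam M x := by
    rw [← rootPotential_neg lam hM x, ← rootPotential_periodic lam hM (-x)]
    congr 1; ring
  have key : rootPotential lam M x + rootPotential lam M (Real.pi / M - x)
      < 2 * rootPotential lam M (Real.pi / (2 * M)) := by
    rw [rootPotential, rootPotential, rootPotential, ← Finset.sum_add_distrib, Finset.mul_sum]
    refine Finset.sum_lt_sum_of_nonempty ⟨0, Finset.mem_range.mpr hM⟩ fun k hk => ?_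
    have hk' : ((k : ℝ) + 1) ≤ M := by exact_mod_cast Finset.mem_range.mp hk
    have hb : Real.pi / M + Real.pi * k / M ≤ Real.pi := by
      rw [← add_div, div_le_iff₀ hM']
      nlinarith [Real.pi_pos]
    have hkk : 0 ≤ Real.pi * k / M := by positivity
    have := abs_sin_rpow_add_lt h0 h1 (s := x + Real.pi * k / M)
      (t := Real.pi / M - x + Real.pi * k / M) ⟨by linarith, by linarith⟩
      ⟨by linarith, by linarith⟩ (by
        intro h
        apply hx
        have : Real.pi / (2 * M) = (Real.pi / M) / 2 := by field_simp
        linarith)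
    have e : (x + Real.pi * k / M + (Real.pi / M - x + Real.pi * k / M)) / 2
        = Real.pi / (2 * M) + Real.pi * k / M := by field_simp; ring
    rwa [e] at this
  linarith

/-- The equality case is phrased as `z^M = -1` for `z = exp (2 i x)`, the form in which greedy
points are located. -/
theorem rootPotential_le_and_eq {lam : ℝ} (h0 : 0 < lam) (h1 : lam ≤ 1) {M : ℕ} (hM : 0 < M)
    (x : ℝ) :
    rootPotential lam M x ≤ rootPotential lam M (Real.pi / (2 * M)) ∧
      (rootPotential lam M x = rootPotential lam M (Real.pi / (2 * M)) →
        Circle.exp (M * (2 * x)) = Circle.exp Real.pi) := by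
  have hM' : (0 : ℝ) < M := by positivity
  have hp : 0 < Real.pi / M := by positivity
  obtain ⟨n, ⟨hy0, hy1⟩, -⟩ := existsUnique_zsmul_near_of_pos' hp x
  have hyx : rootPotential lam M x = rootPotential lam M (x - n • (Real.pi / M)) :=
    ((rootPotential_periodic lam hM).sub_zsmul_eq n).symm
  set y := x - n • (Real.pi / M) with hydef
  by_cases hy : y = Real.pi / (2 * M)
  · refine ⟨by rw [hyx, hy], fun _ => ?_⟩
    rw [Circle.exp_eq_exp]
    refine ⟨n, ?_⟩
    have hx : x = Real.pi / (2 * M) + n * (Real.pi / M) := by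
      rw [← hy, hydef, zsmul_eq_mul]; ring
    rw [hx]
    field_simp
  · have := rootPotential_lt h0 h1 hM hy0 hy1.le hy
    exact ⟨by rw [hyx]; exact this.le, fun h => absurd (hyx ▸ h) this.ne⟩

theorem sum_range_two_mul {f : ℕ → ℝ} (n : ℕ) :
    ∑ k ∈ Finset.range (2 * n), f k
      = ∑ k ∈ Finset.range n, f (2 * k) + ∑ k ∈ Finset.range n, f (2 * k + 1) := by
  induction n with
  | zero => simp
  | succ n ih =>
    rw [Nat.mul_succ, Finset.sum_range_succ, Finset.sum_range_succ, ih, Finset.sum_range_succ,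
      Finset.sum_range_succ]
    ring

/-- Even-indexed `2M`-th roots are the `M`-th roots, odd-indexed ones the midpoints. This makes the
maximum of the potential a difference of two values at `0`. -/
theorem rootPotential_two_mul (lam : ℝ) {M : ℕ} (hM : 0 < M) :
    rootPotential lam (2 * M) 0
      = rootPotential lam M 0 + rootPotential lam M (Real.pi / (2 * M)) := by
  have hM' : (M : ℝ) ≠ 0 := by positivity
  rw [rootPotential, sum_range_two_mul]
  congr 1 <;> refine Finset.sum_congr rfl fun k _ => ?_ <;> congr 4 <;> push_cast <;> field_simp
  ring

/-! ### Greedy sections of dyadic length -/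

theorem rootPotential_eq_of_exp {lam : ℝ} {M : ℕ} (hM : 0 < M) {x y : ℝ}
    (h : Circle.exp (M * (2 * x)) = Circle.exp (M * (2 * y))) :
    rootPotential lam M x = rootPotential lam M y := by
  have hM' : (M : ℝ) ≠ 0 := by positivity
  obtain ⟨m, hm⟩ := Circle.exp_eq_exp.mp h
  have : x = y + m • (Real.pi / M) := by
    rw [zsmul_eq_mul]
    field_simp
    linarith
  rw [this]
  exact (rootPotential_periodic lam hM).zsmul m y

theorem Circle_exp_pow (t : ℝ) (n : ℕ) : Circle.exp t ^ n = Circle.exp (n * t) := by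
  rw [← nsmul_eq_mul, Circle.exp_nsmul]

open scoped Classical in
-- There are only `M` roots, so distinct ones exhaust them. The negative angles produce the sign `x
-- + π k / M` of `rootPotential`.
theorem image_eq_of_pow_eq_one {M : ℕ} (hM : 0 < M) {b : ℕ → Circle}
    (hb : ∀ i < M, b i ^ M = 1) (hinj : Set.InjOn b (Finset.range M)) :
    (Finset.range M).image b
      = (Finset.range M).image fun k : ℕ => Circle.exp (-(2 * Real.pi * k / M)) := by
  have hM' : (M : ℝ) ≠ 0 := by positivity
  refine Finset.eq_of_subset_of_card_le ?_ ?_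
  · intro z hz
    obtain ⟨i, hi, rfl⟩ := Finset.mem_image.mp hz
    have h := hb i (Finset.mem_range.mp hi)
    rw [← Circle.exp_arg (b i)] at h ⊢
    generalize (Complex.arg (b i)) = t at h ⊢
    rw [Circle_exp_pow] at h
    obtain ⟨m, hm⟩ := Circle.exp_eq_one.mp h
    have hpos : (0 : ℤ) < M := by exact_mod_cast hM
    refine Finset.mem_image.mpr ⟨((-m) % M).toNat, ?_, ?_⟩
    · rw [Finset.mem_range]
      have := Int.emod_lt_of_pos (-m) hpos
      have := Int.emod_nonneg (-m) hpos.ne'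
      omega
    · rw [Circle.exp_eq_exp]
      refine ⟨(-m) / M, ?_⟩
      have h1 : ((((-m) % M).toNat : ℕ) : ℝ) = (-m : ℝ) - M * (((-m) / M : ℤ) : ℝ) := by
        have h2 : ((((-m) % M).toNat : ℕ) : ℤ) = -m - M * ((-m) / M) := by
          rw [Int.toNat_of_nonneg (Int.emod_nonneg _ hpos.ne'), Int.emod_def]
        exact_mod_cast congrArg (Int.cast : ℤ → ℝ) h2
      rw [h1]
      field_simp
      linarith
  · rw [Finset.card_image_of_injOn hinj]
    exact Finset.card_image_le

theorem potential_eq_rootPotential (lam : ℝ) {M : ℕ} (hM : 0 < M) {b : ℕ → Circle}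
    (hb : ∀ i < M, b i ^ M = 1) (hinj : Set.InjOn b (Finset.range M)) (t : ℝ) :
    potential lam b M (Circle.exp t) = rootPotential lam M (t / 2) := by
  have hM' : (M : ℝ) ≠ 0 := by positivity
  classical
  have himg := image_eq_of_pow_eq_one hM hb hinj
  have hinj' : Set.InjOn (fun k : ℕ => Circle.exp (-(2 * Real.pi * k / M))) (Finset.range M) := by
    rw [← Finset.card_image_iff, ← himg, Finset.card_image_iff.mpr hinj]
  calc potential lam b M (Circle.exp t)
      = ∑ z ∈ (Finset.range M).image b, ‖(Circle.exp t : ℂ) - (z : ℂ)‖ ^ lam :=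
        (Finset.sum_image (f := fun z : Circle => ‖(Circle.exp t : ℂ) - (z : ℂ)‖ ^ lam) hinj).symm
    _ = rootPotential lam M (t / 2) := by
        rw [himg, Finset.sum_image hinj']
        refine Finset.sum_congr rfl fun k _ => ?_
        rw [norm_exp_sub_exp]
        congr 4
        field_simp
        ring

theorem potential_eq_of_pow_eq (lam : ℝ) {M : ℕ} (hM : 0 < M) {b : ℕ → Circle}
    (hb : ∀ i < M, b i ^ M = 1) (hinj : Set.InjOn b (Finset.range M)) {z : Circle} {x : ℝ}
    (hz : z ^ M = Circle.exp (M * (2 * x))) : potential lam b M z = rootPotential lam M x := by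
  obtain ⟨t, rfl⟩ := Circle.exp_surjective z
  rw [potential_eq_rootPotential lam hM hb hinj]
  refine rootPotential_eq_of_exp hM ?_
  rw [← hz, Circle_exp_pow, mul_div_cancel₀ t two_ne_zero]

theorem exp_mul_two_mul_pi_div {M : ℕ} (hM : 0 < M) :
    Circle.exp (M * (2 * (Real.pi / (2 * M)))) = Circle.exp Real.pi := by
  congr 1
  field_simp

theorem potential_of_pow_eq_one (lam : ℝ) {M : ℕ} (hM : 0 < M) {b : ℕ → Circle}
    (hb : ∀ i < M, b i ^ M = 1) (hinj : Set.InjOn b (Finset.range M)) {z : Circle}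
    (hz : z ^ M = 1) : potential lam b M z = rootPotential lam M 0 :=
  potential_eq_of_pow_eq lam hM hb hinj (by simpa using hz)

theorem potential_of_pow_eq_exp_pi (lam : ℝ) {M : ℕ} (hM : 0 < M) {b : ℕ → Circle}
    (hb : ∀ i < M, b i ^ M = 1) (hinj : Set.InjOn b (Finset.range M)) {z : Circle}
    (hz : z ^ M = Circle.exp Real.pi) :
    potential lam b M z = rootPotential lam M (Real.pi / (2 * M)) :=
  potential_eq_of_pow_eq lam hM hb hinj (hz.trans (exp_mul_two_mul_pi_div hM).symm)

/-- The first `N` points of `b` are chosen greedily. -/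
def GreedyUpTo (lam : ℝ) (b : ℕ → Circle) (N : ℕ) : Prop :=
  ∀ n, 1 ≤ n → n < N → ∀ x : Circle, potential lam b n x ≤ potential lam b n (b n)

theorem GreedyUpTo.mono {lam : ℝ} {b : ℕ → Circle} {N N' : ℕ} (h : GreedyUpTo lam b N)
    (hN : N' ≤ N) : GreedyUpTo lam b N' :=
  fun n h1 h2 => h n h1 (h2.trans_le hN)

theorem potential_congr {lam : ℝ} {b c : ℕ → Circle} {n : ℕ} (h : ∀ i < n, b i = c i)
    (x : Circle) : potential lam b n x = potential lam c n x :=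
  Finset.sum_congr rfl fun k hk => by rw [h k (Finset.mem_range.mp hk)]

theorem continuous_potential {lam : ℝ} (h0 : 0 ≤ lam) (b : ℕ → Circle) (n : ℕ) :
    Continuous (potential lam b n) := by
  unfold potential
  refine continuous_finsetSum _ fun k _ => ?_
  exact ((continuous_subtype_val.sub continuous_const).norm).rpow_const fun _ => Or.inr h0

theorem GreedyUpTo.exists_extension {lam : ℝ} (h0 : 0 ≤ lam) {b : ℕ → Circle} {n : ℕ}
    (h : GreedyUpTo lam b n) :
    ∃ y, (∀ x, potential lam b n x ≤ potential lam b n y) ∧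
      GreedyUpTo lam (Function.update b n y) (n + 1) := by
  obtain ⟨y, -, hy⟩ := isCompact_univ.exists_isMaxOn Set.univ_nonempty
    (continuous_potential h0 b n).continuousOn
  replace hy : ∀ x, potential lam b n x ≤ potential lam b n y := fun x => hy (Set.mem_univ x)
  refine ⟨y, hy, fun m hm1 hm2 x => ?_⟩
  have hc : ∀ z, potential lam (Function.update b n y) m z = potential lam b m z := fun z =>
    potential_congr (fun i hi => by
      have hin : i ≠ n := by omega
      rw [Function.update_of_ne hin]) z
  rw [hc, hc]
  rcases Nat.lt_succ_iff_lt_or_eq.mp hm2 with hlt | rfl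
  · rw [Function.update_of_ne hlt.ne]
    exact h m hm1 hlt x
  · rw [Function.update_self]
    exact hy x

/-- The points `b M, b (M + 1), …`, rotated so that the first one is `1`. -/
def shiftRotate (b : ℕ → Circle) (M : ℕ) : ℕ → Circle := fun i => b (M + i) / b M

@[simp] theorem shiftRotate_zero (b : ℕ → Circle) (M : ℕ) : shiftRotate b M 0 = 1 := by
  simp [shiftRotate]

theorem mul_shiftRotate (b : ℕ → Circle) (M i : ℕ) : b M * shiftRotate b M i = b (M + i) :=
  mul_div_cancel _ _

theorem norm_mul_sub_mul (w x y : Circle) :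
    ‖((w * x : Circle) : ℂ) - ((w * y : Circle) : ℂ)‖ = ‖(x : ℂ) - (y : ℂ)‖ := by
  rw [Circle.coe_mul, Circle.coe_mul, ← mul_sub, norm_mul, Circle.norm_coe, one_mul]

theorem potential_add (lam : ℝ) (b : ℕ → Circle) (M i : ℕ) (x : Circle) :
    potential lam b (M + i) (b M * x)
      = potential lam b M (b M * x) + potential lam (shiftRotate b M) i x := by
  rw [potential, Finset.sum_range_add]
  congr 1
  refine Finset.sum_congr rfl fun k _ => ?_
  rw [← mul_shiftRotate b M k, norm_mul_sub_mul]

/-- Greedy sections of length at most `M` consist of distinct `M`-th roots of unity. -/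
def HasRootSections (lam : ℝ) (M : ℕ) : Prop :=
  ∀ N ≤ M, ∀ b : ℕ → Circle, b 0 = 1 → GreedyUpTo lam b N →
    (∀ i < N, b i ^ M = 1) ∧ Set.InjOn b (Finset.range N)

/-- The heart of the structure theorem: the root potential and the potential of the rotated tail
have a common maximizer, so each greedy point maximizes both. -/
theorem HasRootSections.shiftRotate {lam : ℝ} (h0 : 0 < lam) (h1 : lam ≤ 1) {M : ℕ} (hM : 0 < M)
    (hP : HasRootSections lam M) {m : ℕ} (hm : m ≤ M) {b : ℕ → Circle} (hb0 : b 0 = 1)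
    (hb : GreedyUpTo lam b (M + m)) :
    (∀ i < m, b (M + i) ^ M = Circle.exp Real.pi) ∧
      GreedyUpTo lam (GreedyCircle.shiftRotate b M) m := by
  obtain ⟨hroot, hinj⟩ := hP M le_rfl b hb0 (hb.mono (by omega))
  set c := GreedyCircle.shiftRotate b M with hc
  have hle : ∀ x, potential lam b M x ≤ rootPotential lam M (Real.pi / (2 * M)) := by
    intro x
    obtain ⟨t, rfl⟩ := Circle.exp_surjective x
    rw [potential_eq_rootPotential lam hM hroot hinj]
    exact (rootPotential_le_and_eq h0 h1 hM _).1
  have heq : ∀ x, rootPotential lam M (Real.pi / (2 * M)) ≤ potential lam b M x →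
      x ^ M = Circle.exp Real.pi := by
    intro x hx
    have hx' := le_antisymm (hle x) hx
    obtain ⟨t, rfl⟩ := Circle.exp_surjective x
    rw [potential_eq_rootPotential lam hM hroot hinj] at hx'
    have := (rootPotential_le_and_eq h0 h1 hM _).2 hx'
    rwa [mul_div_cancel₀ t two_ne_zero, ← Circle_exp_pow] at this
  have hfirst : 0 < m → b M ^ M = Circle.exp Real.pi := by
    intro hm0
    refine heq _ ?_
    have hz : Circle.exp (2 * (Real.pi / (2 * M))) ^ M = Circle.exp Real.pi := by
      rw [Circle_exp_pow, exp_mul_two_mul_pi_div hM]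
    rw [← potential_of_pow_eq_exp_pi lam hM hroot hinj hz]
    exact hb M hM (by omega) _
  have hstep : ∀ i, 1 ≤ i → i < m → GreedyUpTo lam c i →
      b (M + i) ^ M = Circle.exp Real.pi ∧ ∀ x, potential lam c i x ≤ potential lam c i (c i) := by
    intro i hi1 him hci
    -- Whether `c i` maximizes the tail potential is not yet known, so `hP` is applied to `c` with
    -- its `i`-th value replaced by a true maximizer `y`; the length `i + 1 ≤ m ≤ M` is admissible.
    obtain ⟨y, hy, hext⟩ := hci.exists_extension h0.le
    have hyM : y ^ M = 1 := by
      have := (hP (i + 1) (by omega) _ (by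
        rw [Function.update_of_ne (by omega)]; simp [hc]) hext).1 i (Nat.lt_succ_self i)
      rwa [Function.update_self] at this
    have hz : (b M * y) ^ M = Circle.exp Real.pi := by
      rw [mul_pow, hyM, mul_one, hfirst (by omega)]
    -- At `b M * y` both summands attain their maxima. The greedy point does at least as well in
    -- total, so it loses nothing in either summand.
    have h2 := hb (M + i) (by omega) (by omega) (b M * y)
    rw [← mul_shiftRotate b M i, potential_add, potential_add, mul_shiftRotate,
      potential_of_pow_eq_exp_pi lam hM hroot hinj hz, ← hc] at h2
    have h3 := hy (c i)
    have h4 := hle (b (M + i))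
    exact ⟨heq _ (by linarith), fun x => (hy x).trans (by linarith)⟩
  have hgreedy : ∀ i ≤ m, GreedyUpTo lam c i := by
    intro i
    induction i with
    | zero => intro _ n _ h; omega
    | succ i ih =>
      intro hi n hn1 hn2 x
      have hci := ih (by omega)
      rcases Nat.lt_succ_iff_lt_or_eq.mp hn2 with hlt | rfl
      · exact hci n hn1 hlt x
      · exact (hstep n hn1 (by omega) hci).2 x
  refine ⟨fun i hi => ?_, hgreedy m le_rfl⟩
  rcases Nat.eq_zero_or_pos i with rfl | hi0
  · exact hfirst hi
  · exact (hstep i hi0 hi (hgreedy i hi.le)).1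

theorem Circle_exp_pi_ne_one : Circle.exp Real.pi ≠ 1 := by
  intro h
  have := congrArg (fun z : Circle => (z : ℂ)) h
  simp [Circle.coe_exp, Complex.exp_pi_mul_I] at this
  norm_num at this

theorem Circle_exp_pi_sq : Circle.exp Real.pi ^ 2 = 1 := by
  rw [Circle_exp_pow, Nat.cast_two, Circle.exp_two_pi]

/-- The two halves cannot meet, since their `M`-th powers are `1` and `-1`. -/
theorem HasRootSections.two_mul {lam : ℝ} (h0 : 0 < lam) (h1 : lam ≤ 1) {M : ℕ} (hM : 0 < M)
    (hP : HasRootSections lam M) : HasRootSections lam (2 * M) := by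
  intro N hN b hb0 hb
  rcases le_or_gt N M with hNM | hNM
  · obtain ⟨hr, hi⟩ := hP N hNM b hb0 hb
    exact ⟨fun i hi => by rw [mul_comm, pow_mul, hr i hi, one_pow], hi⟩
  obtain ⟨m, rfl⟩ := Nat.exists_eq_add_of_lt hNM
  rw [add_assoc] at *
  set m' := m + 1
  obtain ⟨hr, hi⟩ := hP M le_rfl b hb0 (hb.mono (by omega))
  obtain ⟨hpi, hg⟩ := hP.shiftRotate h0 h1 hM (m := m') (by omega) hb0 hb
  obtain ⟨-, hi'⟩ := hP m' (by omega) _ (shiftRotate_zero b M) hg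
  have hlow : ∀ i < M + m', i < M ∨ ∃ k < m', i = M + k := fun i hi => by
    rcases lt_or_ge i M with h | h
    · exact Or.inl h
    · exact Or.inr ⟨i - M, by omega, by omega⟩
  refine ⟨fun i hi => ?_, ?_⟩
  · rcases hlow i hi with h | ⟨k, hk, rfl⟩
    · rw [mul_comm, pow_mul, hr i h, one_pow]
    · rw [mul_comm, pow_mul, hpi k hk, Circle_exp_pi_sq]
  · intro i hi1 j hj1 hij
    rw [Finset.coe_range, Set.mem_Iio] at hi1 hj1
    rcases hlow i hi1 with h | ⟨k, hk, rfl⟩ <;> rcases hlow j hj1 with h' | ⟨l, hl, rfl⟩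
    · exact hi (by simpa using h) (by simpa using h') hij
    · exact absurd (by rw [← hpi l hl, ← hij, hr i h]) Circle_exp_pi_ne_one
    · exact absurd (by rw [← hpi k hk, hij, hr j h']) Circle_exp_pi_ne_one
    · have := hi' (by simpa using hk) (by simpa using hl) (by
        simp only [GreedyCircle.shiftRotate, hij])
      rw [this]

theorem hasRootSections_two_pow {lam : ℝ} (h0 : 0 < lam) (h1 : lam ≤ 1) (q : ℕ) :
    HasRootSections lam (2 ^ q) := by
  induction q with
  | zero =>
    intro N hN b hb0 _
    rw [pow_zero] at hN
    refine ⟨fun i hi => ?_, fun i hi j hj _ => ?_⟩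
    · obtain rfl : i = 0 := by omega
      rw [hb0, one_pow]
    · rw [Finset.coe_range, Set.mem_Iio] at hi hj
      omega
  | succ q ih =>
    rw [pow_succ, mul_comm]
    exact ih.two_mul h0 h1 (by positivity)

/-! ### The energy of a greedy section in terms of the binary expansion of its length -/

/-- The energy of the first `N` points, with the vanishing diagonal terms included. -/
def sectionEnergy (lam : ℝ) (b : ℕ → Circle) (N : ℕ) : ℝ :=
  ∑ i ∈ Finset.range N, potential lam b N (b i)

theorem energy_firstPoints {lam : ℝ} (h0 : 0 < lam) (b : ℕ → Circle) (N : ℕ) :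
    energy lam (firstPoints b N) = sectionEnergy lam b N := by
  rw [energy, sectionEnergy, ← Fin.sum_univ_eq_sum_range (fun i => potential lam b N (b i))]
  refine Finset.sum_congr rfl fun i _ => ?_
  rw [potential, ← Fin.sum_univ_eq_sum_range (fun k => ‖(b i : ℂ) - (b k : ℂ)‖ ^ lam),
    ← Finset.add_sum_erase _ _ (Finset.mem_univ i)]
  simp [firstPoints, Real.zero_rpow h0.ne']

theorem sectionEnergy_add (lam : ℝ) (b : ℕ → Circle) (M m : ℕ) :
    sectionEnergy lam b (M + m) = sectionEnergy lam b M
      + 2 * ∑ i ∈ Finset.range m, potential lam b M (b (M + i))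
      + sectionEnergy lam (shiftRotate b M) m := by
  have hsplit : ∀ x, potential lam b (M + m) x
      = potential lam b M x + ∑ i ∈ Finset.range m, ‖(x : ℂ) - (b (M + i) : ℂ)‖ ^ lam :=
    fun x => by rw [potential, Finset.sum_range_add, potential]
  have hcross : ∑ i ∈ Finset.range M, ∑ j ∈ Finset.range m, ‖(b i : ℂ) - (b (M + j) : ℂ)‖ ^ lam
      = ∑ i ∈ Finset.range m, potential lam b M (b (M + i)) := by
    rw [Finset.sum_comm]
    refine Finset.sum_congr rfl fun i _ => Finset.sum_congr rfl fun j _ => ?_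
    rw [norm_sub_rev]
  have hlast : ∑ i ∈ Finset.range m, ∑ j ∈ Finset.range m,
      ‖(b (M + i) : ℂ) - (b (M + j) : ℂ)‖ ^ lam = sectionEnergy lam (shiftRotate b M) m := by
    refine Finset.sum_congr rfl fun i _ => Finset.sum_congr rfl fun j _ => ?_
    rw [← mul_shiftRotate b M i, ← mul_shiftRotate b M j, norm_mul_sub_mul]
  rw [sectionEnergy, Finset.sum_range_add]
  simp only [hsplit, Finset.sum_add_distrib]
  rw [hcross, hlast, sectionEnergy, sectionEnergy]
  ring

theorem binSum_succ {p : ℕ} (n : Fin (p + 1) → ℕ) :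
    binSum n = 2 ^ n 0 + binSum (fun i => n i.succ) := Fin.sum_univ_succ _

theorem StrictAnti.tail {p : ℕ} {n : Fin (p + 1) → ℕ} (hn : StrictAnti n) :
    StrictAnti fun i : Fin p => n i.succ :=
  fun _ _ h => hn (Fin.succ_lt_succ_iff.mpr h)

theorem binSum_lt {p : ℕ} {n : Fin p → ℕ} (hn : StrictAnti n) {q : ℕ} (hq : ∀ i, n i < q) :
    binSum n < 2 ^ q := by
  induction p generalizing q with
  | zero => simp [binSum]
  | succ p ih =>
    have h := ih (StrictAnti.tail hn) (q := n 0) fun i => hn (Fin.succ_pos i)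
    rw [binSum_succ]
    calc 2 ^ n 0 + binSum (fun i => n i.succ) < 2 ^ n 0 + 2 ^ n 0 := by omega
      _ = 2 ^ (n 0 + 1) := by ring
      _ ≤ 2 ^ q := Nat.pow_le_pow_right (by norm_num) (hq 0)

/-- Peel off the leading power of two: its points are all roots of unity, every later point sees
them from a midpoint, and the rotated tail is a greedy section with one binary digit fewer. -/
theorem sectionEnergy_binSum {lam : ℝ} (h0 : 0 < lam) (h1 : lam ≤ 1) {p : ℕ} {n : Fin p → ℕ}
    (hn : StrictAnti n) {b : ℕ → Circle} (hb0 : b 0 = 1) (hb : GreedyUpTo lam b (binSum n)) :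
    sectionEnergy lam b (binSum n)
      = ∑ k, (2 ^ n k * rootPotential lam (2 ^ n k) 0
        + 2 * (rootPotential lam (2 ^ (n k + 1)) 0 - rootPotential lam (2 ^ n k) 0)
          * ∑ j ∈ Finset.Ioi k, (2 : ℝ) ^ n j) := by
  induction p generalizing b with
  | zero => simp [binSum, sectionEnergy]
  | succ p ih =>
    rw [binSum_succ] at hb ⊢
    have hn' := StrictAnti.tail hn
    have hm : binSum (fun i => n i.succ) < 2 ^ n 0 :=
      binSum_lt hn' fun i => hn (Fin.succ_pos i)
    have hpos : 0 < 2 ^ n 0 := by positivity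
    have hP := hasRootSections_two_pow h0 h1 (n 0)
    obtain ⟨hr, hi⟩ := hP _ le_rfl b hb0 (hb.mono (by omega))
    obtain ⟨hpi, hg⟩ := hP.shiftRotate h0 h1 hpos hm.le hb0 hb
    have hA : sectionEnergy lam b (2 ^ n 0) = 2 ^ n 0 * rootPotential lam (2 ^ n 0) 0 := by
      rw [sectionEnergy, Finset.sum_congr rfl fun i hi' => potential_of_pow_eq_one lam hpos hr hi
        (hr i (Finset.mem_range.mp hi'))]
      simp
    have hB : ∑ i ∈ Finset.range (binSum fun i => n i.succ), potential lam b (2 ^ n 0)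
        (b (2 ^ n 0 + i)) = (rootPotential lam (2 ^ (n 0 + 1)) 0 - rootPotential lam (2 ^ n 0) 0)
          * ∑ j : Fin p, (2 : ℝ) ^ n j.succ := by
      rw [Finset.sum_congr rfl fun i hi' => potential_of_pow_eq_exp_pi lam hpos hr hi
        (hpi i (Finset.mem_range.mp hi')), pow_succ, mul_comm (2 ^ n 0) 2,
        rootPotential_two_mul lam hpos]
      simp [binSum]
      ring
    rw [sectionEnergy_add, ih hn' (shiftRotate_zero _ _) hg, hA, hB, Fin.sum_univ_succ,
      Fin.sum_Ioi_zero]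
    simp only [Fin.sum_Ioi_succ]
    ring

theorem exists_binSum_eq (N : ℕ) : ∃ (p : ℕ) (n : Fin p → ℕ), StrictAnti n ∧ binSum n = N := by
  induction N using Nat.strong_induction_on with
  | _ N ih =>
    rcases Nat.eq_zero_or_pos N with rfl | hN
    · exact ⟨0, Fin.elim0, fun i => i.elim0, by simp [binSum]⟩
    have h1 : 2 ^ Nat.log 2 N ≤ N := Nat.pow_log_le_self 2 hN.ne'
    have h2 : N < 2 ^ (Nat.log 2 N + 1) := Nat.lt_pow_succ_log_self (by norm_num) N
    have h3 : 0 < 2 ^ Nat.log 2 N := by positivity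
    obtain ⟨p, n, hn, hs⟩ := ih (N - 2 ^ Nat.log 2 N) (by omega)
    refine ⟨p + 1, Fin.cons (Nat.log 2 N) n, ?_, ?_⟩
    · intro i j hij
      refine Fin.cases (fun hij => ?_) (fun i hij => ?_) i hij
      · obtain ⟨j, rfl⟩ := Fin.exists_succ_eq.mpr hij.ne'
        rw [Fin.cons_zero, Fin.cons_succ]
        have h4 : 2 ^ n j ≤ binSum n := Finset.single_le_sum (f := fun i => 2 ^ n i)
          (fun _ _ => Nat.zero_le _) (Finset.mem_univ j)
        have h5 : 2 ^ n j < 2 ^ Nat.log 2 N := by rw [pow_succ] at h2; omega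
        exact (Nat.pow_lt_pow_iff_right (by norm_num)).mp h5
      · obtain ⟨j, rfl⟩ := Fin.exists_succ_eq.mpr (Fin.pos_iff_ne_zero.mp ((Fin.zero_le _).trans_lt hij))
        rw [Fin.cons_succ, Fin.cons_succ]
        exact hn (Fin.succ_lt_succ_iff.mp hij)
    · rw [binSum_succ]
      simp only [Fin.cons_zero, Fin.cons_succ]
      change 2 ^ Nat.log 2 N + binSum n = N
      omega

/-! ### The function `G` on the vectors coming from binary expansions -/

/-- The vector `(2^{n_i} / N)_i` where `N = ∑ i, 2^{n_i}`. -/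
def binVec {p : ℕ} (n : Fin p → ℕ) : Fin p → ℝ := fun i => (2 : ℝ) ^ n i / (binSum n : ℝ)

theorem binSum_pos {p : ℕ} (n : Fin (p + 1) → ℕ) : 0 < binSum n := by
  rw [binSum_succ]; positivity

theorem cast_binSum {p : ℕ} (n : Fin p → ℕ) : (binSum n : ℝ) = ∑ i, (2 : ℝ) ^ n i := by
  simp [binSum]

theorem binVec_pos {p : ℕ} (n : Fin p → ℕ) (k : Fin p) : 0 < binVec n k := by
  have : 0 < binSum n := (show 0 < 2 ^ n k by positivity).trans_le
    (Finset.single_le_sum (f := fun i => 2 ^ n i) (fun _ _ => Nat.zero_le _) (Finset.mem_univ k))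
  unfold binVec
  positivity

theorem sum_Ioi_two_pow_le {p : ℕ} {n : Fin p → ℕ} (hn : StrictAnti n) (k : Fin p) :
    ∑ j ∈ Finset.Ioi k, (2 : ℝ) ^ n j ≤ 2 ^ n k := by
  induction p with
  | zero => exact k.elim0
  | succ p ih =>
    refine Fin.cases ?_ (fun k => ?_) k
    · rw [Fin.sum_Ioi_zero]
      have := binSum_lt (StrictAnti.tail hn) (q := n 0) fun i => hn (Fin.succ_pos i)
      rw [← cast_binSum fun i => n i.succ]
      exact_mod_cast this.le
    · rw [Fin.sum_Ioi_succ]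
      exact ih (StrictAnti.tail hn) k

theorem sum_Ioi_binVec_le {p : ℕ} {n : Fin p → ℕ} (hn : StrictAnti n) (k : Fin p) :
    ∑ j ∈ Finset.Ioi k, binVec n j ≤ binVec n k := by
  unfold binVec
  rw [← Finset.sum_div]
  exact div_le_div_of_nonneg_right (sum_Ioi_two_pow_le hn k) (Nat.cast_nonneg _)

theorem sum_Ioi_binVec_nonneg {p : ℕ} (n : Fin p → ℕ) (k : Fin p) :
    0 ≤ ∑ j ∈ Finset.Ioi k, binVec n j :=
  Finset.sum_nonneg fun j _ => (binVec_pos n j).le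

theorem G_binVec {p : ℕ} (n : Fin p → ℕ) (lam : ℝ) :
    G (binVec n) lam = ∑ k, binVec n k ^ (-lam) *
      (2 * ((2 : ℝ) ^ (-lam) - 1) * (∑ j ∈ Finset.Ioi k, binVec n j) + binVec n k) :=
  Finset.sum_congr rfl fun k _ => if_neg (binVec_pos n k).ne'

theorem sq_sum_fin {p : ℕ} (x : Fin p → ℝ) :
    (∑ k, x k) ^ 2 = ∑ k, (x k ^ 2 + 2 * x k * ∑ j ∈ Finset.Ioi k, x j) := by
  induction p with
  | zero => simp
  | succ p ih =>
    rw [Fin.sum_univ_succ, Fin.sum_univ_succ, Fin.sum_Ioi_zero]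
    simp only [Fin.sum_Ioi_succ]
    rw [← ih fun i => x i.succ]
    ring

/-- The normalized second order term of the energy of the `2^q`-th roots of unity. -/
def dyadicRemainder (lam : ℝ) (q : ℕ) : ℝ :=
  ((2 : ℝ) ^ q) ^ lam * (rootPotential lam (2 ^ q) 0 - 2 ^ q * contEnergy lam sigma1)

theorem IsGreedy.greedyUpTo {lam : ℝ} {a : ℕ → Circle} (ha : IsGreedy lam a) (N : ℕ) :
    GreedyUpTo lam a N := fun n h1 _ => ha.greedy n h1

/-- Expanding `N^2` over the digits matches the energy term by term. The factor `2^(-lam)`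
compensates the normalization of `dyadicRemainder` at `2M`; with a constant remainder `c` the sum is
`c * G`. -/
theorem secondOrder_binSum {lam : ℝ} (h0 : 0 < lam) (h1 : lam ≤ 1) {a : ℕ → Circle}
    (ha : IsGreedy lam a) {p : ℕ} {n : Fin (p + 1) → ℕ} (hn : StrictAnti n) :
    secondOrder lam a (binSum n) = ∑ k, binVec n k ^ (-lam) *
      (2 * ((2 : ℝ) ^ (-lam) * dyadicRemainder lam (n k + 1) - dyadicRemainder lam (n k))
        * (∑ j ∈ Finset.Ioi k, binVec n j) + dyadicRemainder lam (n k) * binVec n k) := by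
  have hN : (0 : ℝ) < binSum n := by exact_mod_cast binSum_pos n
  rw [secondOrder, energy_firstPoints h0, sectionEnergy_binSum h0 h1 hn ha.init (ha.greedyUpTo _),
    cast_binSum, sq_sum_fin, Finset.sum_mul, ← Finset.sum_sub_distrib, Finset.sum_div, ← cast_binSum]
  refine Finset.sum_congr rfl fun k _ => ?_
  have hM : (0 : ℝ) < 2 ^ n k := by positivity
  have hMl : (0 : ℝ) < ((2 : ℝ) ^ n k) ^ lam := by positivity
  have hNl : (0 : ℝ) < (binSum n : ℝ) ^ lam := by positivity
  have h2l : (0 : ℝ) < (2 : ℝ) ^ lam := by positivity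
  have hv : binVec n k = 2 ^ n k / (binSum n : ℝ) := rfl
  have hs : ∑ j ∈ Finset.Ioi k, binVec n j
      = (∑ j ∈ Finset.Ioi k, (2 : ℝ) ^ n j) / (binSum n : ℝ) := (Finset.sum_div _ _ _).symm
  rw [hs, hv, Real.rpow_neg (by positivity), Real.div_rpow hM.le hN.le, Real.rpow_neg (by norm_num),
    Real.rpow_sub hN, Real.rpow_one, dyadicRemainder, dyadicRemainder, pow_succ (2 : ℝ),
    Real.mul_rpow hM.le (by norm_num)]
  field_simp
  ring

/-! ### Geometric estimates -/

theorem two_rpow_neg_lt_one {lam : ℝ} (h1 : lam < 1) : (2 : ℝ) ^ (-(1 - lam)) < 1 :=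
  Real.rpow_lt_one_of_one_lt_of_neg (by norm_num) (by linarith)

theorem binVec_rpow_le {lam : ℝ} (h1 : lam < 1) {p : ℕ} {n : Fin (p + 1) → ℕ}
    (hn : StrictAnti n) (k : Fin (p + 1)) :
    binVec n k ^ (1 - lam) ≤ ((2 : ℝ) ^ (-(1 - lam))) ^ (n 0 - n k) := by
  have hk : n k ≤ n 0 := hn.antitone (Fin.zero_le k)
  have h2 : binVec n k ≤ ((2 : ℝ)⁻¹) ^ (n 0 - n k) := by
    have hN : (2 : ℝ) ^ n 0 ≤ binSum n := by
      rw [binSum_succ]; push_cast; linarith [(Nat.cast_nonneg (binSum fun i => n i.succ) : (0:ℝ) ≤ _)]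
    calc binVec n k ≤ 2 ^ n k / 2 ^ n 0 := by unfold binVec; gcongr
      _ = ((2 : ℝ)⁻¹) ^ (n 0 - n k) := by
        rw [inv_pow, div_eq_iff (by positivity), ← Nat.sub_add_cancel hk, pow_add,
          Nat.add_sub_cancel]
        field_simp
  calc binVec n k ^ (1 - lam) ≤ (((2 : ℝ)⁻¹) ^ (n 0 - n k)) ^ (1 - lam) :=
        Real.rpow_le_rpow (binVec_pos n k).le h2 (by linarith)
    _ = _ := by
        rw [← Real.rpow_natCast, ← Real.rpow_natCast, ← Real.rpow_mul (by norm_num),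
          ← Real.rpow_mul (by norm_num), Real.inv_rpow (by norm_num), ← Real.rpow_neg (by norm_num)]
        congr 1; ring

/-- The gaps `n 0 - n k` are distinct, so the sum is part of a geometric one; the bound does not
involve `p`. -/
theorem sum_binVec_rpow_mul_le {lam : ℝ} (h1 : lam < 1) {p : ℕ} {n : Fin (p + 1) → ℕ}
    (hn : StrictAnti n) {e : ℕ → ℝ} (he : ∀ q, 0 ≤ e q) :
    ∑ k, binVec n k ^ (1 - lam) * e (n k)
      ≤ ∑ i ∈ Finset.range (n 0 + 1), ((2 : ℝ) ^ (-(1 - lam))) ^ i * e (n 0 - i) := by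
  have hk : ∀ k, n k ≤ n 0 := fun k => hn.antitone (Fin.zero_le k)
  have hinj : Set.InjOn (fun k => n 0 - n k) (Finset.univ : Finset (Fin (p + 1))) := by
    intro i _ j _ hij
    have := hk i
    have := hk j
    refine hn.injective ?_
    simp only at hij
    omega
  calc ∑ k, binVec n k ^ (1 - lam) * e (n k)
      ≤ ∑ k, ((2 : ℝ) ^ (-(1 - lam))) ^ (n 0 - n k) * e (n 0 - (n 0 - n k)) := by
        refine Finset.sum_le_sum fun k _ => ?_
        rw [Nat.sub_sub_self (hk k)]
        exact mul_le_mul_of_nonneg_right (binVec_rpow_le h1 hn k) (he _)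
    _ = ∑ i ∈ Finset.univ.image (fun k => n 0 - n k),
          ((2 : ℝ) ^ (-(1 - lam))) ^ i * e (n 0 - i) :=
        (Finset.sum_image (f := fun i => ((2 : ℝ) ^ (-(1 - lam))) ^ i * e (n 0 - i)) hinj).symm
    _ ≤ _ := by
        refine Finset.sum_le_sum_of_subset_of_nonneg ?_ fun i _ _ => mul_nonneg (by positivity) (he _)
        intro i hi
        obtain ⟨k, -, rfl⟩ := Finset.mem_image.mp hi
        rw [Finset.mem_range]
        omega

/-- Low digits carry errors that need not be small, but their geometric weights are. Dominated
convergence for series makes this precise. -/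
theorem tendsto_geometric_convolution {r : ℝ} (hr0 : 0 ≤ r) (hr1 : r < 1) {e : ℕ → ℝ}
    (he : Tendsto e atTop (𝓝 0)) :
    Tendsto (fun Q => ∑ i ∈ Finset.range (Q + 1), r ^ i * e (Q - i)) atTop (𝓝 0) := by
  obtain ⟨B, hB⟩ : ∃ B, ∀ q, |e q| ≤ B := by
    obtain ⟨B, hB⟩ := (Metric.isBounded_range_of_tendsto e he).exists_norm_le
    exact ⟨B, fun q => hB _ (Set.mem_range_self q)⟩
  have h := tendsto_tsum_of_dominated_convergence (𝓕 := atTop)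
    (f := fun Q i => if i ∈ Finset.range (Q + 1) then r ^ i * e (Q - i) else 0) (g := fun _ => 0)
    (bound := fun i => r ^ i * B) ((summable_geometric_of_lt_one hr0 hr1).mul_right B)
    (fun i => by
      have h2 : Tendsto (fun Q => r ^ i * e (Q - i)) atTop (𝓝 (r ^ i * 0)) :=
        (he.comp (tendsto_sub_atTop_nat i)).const_mul _
      rw [mul_zero] at h2
      refine h2.congr' ?_
      filter_upwards [eventually_ge_atTop i] with Q hQ
      rw [if_pos (Finset.mem_range.mpr (by omega))])
    (Eventually.of_forall fun Q i => by
      have hB0 : 0 ≤ B := (abs_nonneg _).trans (hB 0)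
      split_ifs
      · rw [norm_mul, Real.norm_eq_abs, Real.norm_eq_abs, abs_of_nonneg (pow_nonneg hr0 i)]
        exact mul_le_mul_of_nonneg_left (hB _) (pow_nonneg hr0 i)
      · rw [norm_zero]; positivity)
  rw [tsum_zero] at h
  refine h.congr fun Q => ?_
  rw [tsum_eq_sum (s := Finset.range (Q + 1)) fun i hi => if_neg hi]
  exact Finset.sum_congr rfl fun i hi => if_pos hi

theorem abs_rpow_neg_mul_le {lam x T A B : ℝ} (hx : 0 < x) (hT0 : 0 ≤ T) (hT : T ≤ x) :
    |x ^ (-lam) * (A * T + B * x)| ≤ x ^ (1 - lam) * (|A| + |B|) := by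
  have hpow : x ^ (1 - lam) = x ^ (-lam) * x := by
    rw [sub_eq_neg_add, Real.rpow_add hx, Real.rpow_one]
  have hp : 0 < x ^ (-lam) := Real.rpow_pos_of_pos hx _
  rw [abs_mul, abs_of_pos hp, hpow, mul_assoc]
  refine mul_le_mul_of_nonneg_left ?_ hp.le
  calc |A * T + B * x| ≤ |A * T| + |B * x| := abs_add_le _ _
    _ = |A| * T + |B| * x := by rw [abs_mul, abs_mul, abs_of_nonneg hT0, abs_of_pos hx]
    _ ≤ |A| * x + |B| * x := by gcongr
    _ = x * (|A| + |B|) := by ring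

theorem abs_two_rpow_neg_sub_one_le {lam : ℝ} (h0 : 0 < lam) :
    |2 * ((2 : ℝ) ^ (-lam) - 1)| ≤ 2 := by
  have h1 : (2 : ℝ) ^ (-lam) ≤ 1 :=
    Real.rpow_le_one_of_one_le_of_nonpos (by norm_num) (by linarith)
  have h2 : 0 < (2 : ℝ) ^ (-lam) := by positivity
  rw [abs_le]
  constructor <;> linarith

theorem abs_G_binVec_term_le {lam : ℝ} (h0 : 0 < lam) {p : ℕ} {n : Fin p → ℕ}
    (hn : StrictAnti n) (k : Fin p) :
    |binVec n k ^ (-lam) * (2 * ((2 : ℝ) ^ (-lam) - 1) * (∑ j ∈ Finset.Ioi k, binVec n j)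
      + binVec n k)| ≤ binVec n k ^ (1 - lam) * 3 := by
  have h := abs_rpow_neg_mul_le (lam := lam) (A := 2 * ((2 : ℝ) ^ (-lam) - 1)) (B := 1)
    (binVec_pos n k) (sum_Ioi_binVec_nonneg n k) (sum_Ioi_binVec_le hn k)
  rw [one_mul] at h
  refine h.trans (mul_le_mul_of_nonneg_left ?_ (Real.rpow_nonneg (binVec_pos n k).le _))
  rw [abs_one]
  linarith [abs_two_rpow_neg_sub_one_le h0]

theorem abs_G_binVec_le {lam : ℝ} (h0 : 0 < lam) (h1 : lam < 1) {p : ℕ} {n : Fin (p + 1) → ℕ}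
    (hn : StrictAnti n) : |G (binVec n) lam| ≤ (1 - (2 : ℝ) ^ (-(1 - lam)))⁻¹ * 3 := by
  rw [G_binVec]
  refine (Finset.abs_sum_le_sum_abs _ _).trans ?_
  refine (Finset.sum_le_sum fun k _ => abs_G_binVec_term_le h0 hn k).trans ?_
  refine (sum_binVec_rpow_mul_le h1 hn (e := fun _ => 3) fun _ => by norm_num).trans ?_
  rw [← Finset.sum_mul]
  refine mul_le_mul_of_nonneg_right ?_ (by norm_num)
  rw [← tsum_geometric_of_lt_one (by positivity) (two_rpow_neg_lt_one h1)]
  exact (summable_geometric_of_lt_one (by positivity) (two_rpow_neg_lt_one h1)).sum_le_tsum _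
    fun i _ => by positivity

theorem exists_abs_secondOrder_sub_le {lam : ℝ} (h0 : 0 < lam) (h1 : lam < 1) {a : ℕ → Circle}
    (ha : IsGreedy lam a) {c : ℝ} (hc : Tendsto (dyadicRemainder lam) atTop (𝓝 c)) {ε : ℝ}
    (hε : 0 < ε) : ∃ N₀, ∀ (p : ℕ) (n : Fin p → ℕ), StrictAnti n → N₀ ≤ binSum n →
      |secondOrder lam a (binSum n) - G (binVec n) lam * c| ≤ ε := by
  -- The coefficient of the tail sum contributes `2` to each error, and the diagonal term one more
  -- to the second.
  set e : ℕ → ℝ := fun q => 2 * |dyadicRemainder lam (q + 1) - c| + 3 * |dyadicRemainder lam q - c|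
    with he
  have he0 : ∀ q, 0 ≤ e q := fun q => by positivity
  have hd : Tendsto (fun q => |dyadicRemainder lam q - c|) atTop (𝓝 0) := by
    simpa using (hc.sub_const c).abs
  have het : Tendsto e atTop (𝓝 0) := by
    have h := (((tendsto_add_atTop_iff_nat 1).mpr hd).const_mul 2).add (hd.const_mul 3)
    simpa using h
  have hconv := tendsto_geometric_convolution (r := (2 : ℝ) ^ (-(1 - lam))) (by positivity)
    (two_rpow_neg_lt_one h1) het
  obtain ⟨Q₀, hQ₀⟩ := eventually_atTop.mp (hconv.eventually (Iic_mem_nhds hε))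
  refine ⟨2 ^ Q₀, fun p n hn hN => ?_⟩
  obtain _ | p := p
  · simp [binSum] at hN
  have hlt : binSum n < 2 ^ (n 0 + 1) :=
    binSum_lt hn fun i => Nat.lt_succ_of_le (hn.antitone (Fin.zero_le i))
  have hQ : Q₀ < n 0 + 1 :=
    (Nat.pow_lt_pow_iff_right (by norm_num)).mp (hN.trans_lt hlt)
  refine le_trans ?_ (hQ₀ (n 0) (by omega))
  refine le_trans ?_ (sum_binVec_rpow_mul_le h1 hn he0)
  rw [secondOrder_binSum h0 h1.le ha hn, G_binVec, Finset.sum_mul, ← Finset.sum_sub_distrib]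
  refine (Finset.abs_sum_le_sum_abs _ _).trans (Finset.sum_le_sum fun k _ => ?_)
  have hx := binVec_pos n k
  have key := abs_rpow_neg_mul_le (lam := lam)
    (A := 2 * ((2 : ℝ) ^ (-lam) * (dyadicRemainder lam (n k + 1) - c)
      - (dyadicRemainder lam (n k) - c)))
    (B := dyadicRemainder lam (n k) - c) hx (sum_Ioi_binVec_nonneg n k) (sum_Ioi_binVec_le hn k)
  refine le_trans (le_of_eq ?_) (key.trans (mul_le_mul_of_nonneg_left ?_ (by positivity)))
  · congr 1; ring
  · have h2 : (2 : ℝ) ^ (-lam) ≤ 1 :=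
      Real.rpow_le_one_of_one_le_of_nonpos (by norm_num) (by linarith)
    have h3 : 0 < (2 : ℝ) ^ (-lam) := by positivity
    have h4 : |2 * ((2 : ℝ) ^ (-lam) * (dyadicRemainder lam (n k + 1) - c)
        - (dyadicRemainder lam (n k) - c))|
        ≤ 2 * (|dyadicRemainder lam (n k + 1) - c| + |dyadicRemainder lam (n k) - c|) := by
      rw [abs_mul, abs_two]
      refine mul_le_mul_of_nonneg_left ((abs_sub _ _).trans ?_) (by norm_num)
      rw [abs_mul, abs_of_pos h3]
      gcongr
      exact mul_le_of_le_one_left (abs_nonneg _) h2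
    rw [he]
    linarith

/-! ### Vectors in `Theta` -/

/-- Where `θ k = 0` the term is at most `3 x^(1 - lam)` with `x → 0`, which justifies the zero
convention in `G`. -/
theorem tendsto_G_binVec {lam : ℝ} (h0 : 0 < lam) (h1 : lam < 1) {p : ℕ} {n : ℕ → Fin p → ℕ}
    (hn : ∀ m, StrictAnti (n m)) {θ : Fin p → ℝ}
    (hθ : ∀ i, Tendsto (fun m => binVec (n m) i) atTop (𝓝 (θ i))) :
    Tendsto (fun m => G (binVec (n m)) lam) atTop (𝓝 (G θ lam)) := by
  simp only [G_binVec]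
  refine tendsto_finsetSum _ fun k _ => ?_
  split_ifs with hk
  · have hz : Tendsto (fun m => binVec (n m) k ^ (1 - lam) * 3) atTop (𝓝 0) := by
      have := ((hθ k).rpow_const (p := 1 - lam) (Or.inr (by linarith))).mul_const 3
      rwa [hk, Real.zero_rpow (by linarith), zero_mul] at this
    exact squeeze_zero_norm (fun m => abs_G_binVec_term_le h0 (hn m) k) hz
  · exact ((hθ k).rpow_const (Or.inl hk)).mul
      (((tendsto_finsetSum _ fun j _ => hθ j).const_mul _).add (hθ k))

/-- Raising every exponent by `m` multiplies `N` by `2^m` and leaves the vector unchanged. -/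
theorem binVec_mem_Theta {p : ℕ} {n : Fin (p + 1) → ℕ} (hn : StrictAnti n) :
    binVec n ∈ Theta (p + 1) := by
  have hs : ∀ m, binSum (fun i => n i + m) = binSum n * 2 ^ m := fun m => by
    simp only [binSum, pow_add, Finset.sum_mul]
  refine ⟨fun m i => n i + m, fun m i j h => Nat.add_lt_add_right (hn h) m, fun i j h => ?_,
    fun i => ?_⟩
  · simp only [hs]
    exact Nat.mul_lt_mul_of_pos_left (Nat.pow_lt_pow_right (by norm_num) h) (binSum_pos n)
  · refine tendsto_const_nhds.congr fun m => ?_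
    rw [hs, binVec, pow_add]
    push_cast
    rw [mul_div_mul_right _ _ (by positivity)]

theorem abs_G_le_of_mem_Theta {lam : ℝ} (h0 : 0 < lam) (h1 : lam < 1) {p : ℕ} (hp : 1 ≤ p)
    {θ : Fin p → ℝ} (hθ : θ ∈ Theta p) : |G θ lam| ≤ (1 - (2 : ℝ) ^ (-(1 - lam)))⁻¹ * 3 := by
  obtain ⟨n, hn, -, ht⟩ := hθ
  obtain ⟨p, rfl⟩ := Nat.exists_eq_add_of_le' hp
  exact le_of_tendsto (tendsto_G_binVec h0 h1 hn ht).abs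
    (Eventually.of_forall fun m => abs_G_binVec_le h0 h1 (hn m))

/-! ### The lower bound `1 ≤ G` -/

theorem strictConcaveOn_rpow_sub_rpow {μ : ℝ} (h0 : 0 < μ) (h1 : μ < 1) :
    StrictConcaveOn ℝ (Set.Ici 0) fun x : ℝ => x ^ μ - (1 + x) ^ μ := by
  have hd : ∀ x : ℝ, 0 < x → HasDerivAt (fun x : ℝ => x ^ μ - (1 + x) ^ μ)
      (μ * x ^ (μ - 1) - μ * (1 + x) ^ (μ - 1)) x := by
    intro x hx
    have h2 := (Real.hasDerivAt_rpow_const (x := x) (p := μ) (Or.inl hx.ne'))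
    have h3 := ((hasDerivAt_id x).const_add 1).rpow_const (p := μ)
      (Or.inl (show (1 + id x : ℝ) ≠ 0 by simp only [id]; positivity))
    refine (h2.sub h3).congr_deriv ?_
    simp
  refine StrictAntiOn.strictConcaveOn_of_deriv (convex_Ici 0) ?_ ?_
  · refine (ContinuousOn.sub ?_ ?_)
    · exact (Real.continuous_rpow_const h0.le).continuousOn
    · exact ((Real.continuous_rpow_const h0.le).comp (continuous_const.add continuous_id)).continuousOn
  · rw [interior_Ici]
    have hEq : Set.EqOn (deriv fun x : ℝ => x ^ μ - (1 + x) ^ μ)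
        (fun x => μ * x ^ (μ - 1) - μ * (1 + x) ^ (μ - 1)) (Set.Ioi 0) :=
      fun x hx => (hd x hx).deriv
    refine StrictAntiOn.congr ?_ hEq.symm
    have hd2 : ∀ x : ℝ, 0 < x → HasDerivAt (fun x : ℝ => μ * x ^ (μ - 1) - μ * (1 + x) ^ (μ - 1))
        (μ * ((μ - 1) * x ^ (μ - 1 - 1)) - μ * ((μ - 1) * (1 + x) ^ (μ - 1 - 1))) x := by
      intro x hx
      have h2 := (Real.hasDerivAt_rpow_const (x := x) (p := μ - 1) (Or.inl hx.ne')).const_mul μ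
      have h3 := (((hasDerivAt_id x).const_add 1).rpow_const (p := μ - 1)
        (Or.inl (show (1 + id x : ℝ) ≠ 0 by simp only [id]; positivity))).const_mul μ
      refine (h2.sub h3).congr_deriv ?_
      simp
    refine strictAntiOn_of_deriv_neg (convex_Ioi 0)
      (fun x hx => (hd2 x hx).continuousAt.continuousWithinAt) fun x hx => ?_
    rw [interior_Ioi] at hx
    rw [(hd2 x hx).deriv]
    have hlt : (1 + x) ^ (μ - 1 - 1) < x ^ (μ - 1 - 1) :=
      Real.rpow_lt_rpow_of_neg hx (by linarith) (by linarith)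
    nlinarith [mul_pos h0 (sub_pos.mpr h1)]

/-- On `[0, 1]` the concave function `x^μ - (1 + x)^μ`, `μ = 1 - lam`, lies above its chord, which
has slope `2 - 2^μ`. -/
theorem rpow_one_add_le {lam : ℝ} (h0 : 0 < lam) (h1 : lam < 1) {x : ℝ} (hx0 : 0 ≤ x)
    (hx1 : x ≤ 1) :
    (1 + x) ^ (1 - lam) ≤ 1 + 2 * ((2 : ℝ) ^ (-lam) - 1) * x + x ^ (1 - lam) := by
  have h := (strictConcaveOn_rpow_sub_rpow (μ := 1 - lam) (by linarith) (by linarith)).concaveOn.2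
    (show (0 : ℝ) ∈ Set.Ici 0 by simp) (show (1 : ℝ) ∈ Set.Ici 0 by simp)
    (sub_nonneg.mpr hx1) hx0 (by ring)
  have h2 : (2 : ℝ) ^ (1 - lam) = 2 * 2 ^ (-lam) := by
    rw [sub_eq_add_neg, Real.rpow_add (by norm_num), Real.rpow_one]
  simp only [smul_eq_mul, mul_zero, mul_one, zero_add, add_zero, Real.one_rpow,
    Real.zero_rpow (show (1 - lam) ≠ 0 by linarith)] at h
  norm_num at h
  rw [h2] at h
  linarith

theorem rpow_one_add_half_lt {lam : ℝ} (h0 : 0 < lam) (h1 : lam < 1) :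
    (1 + 1 / 2 : ℝ) ^ (1 - lam)
      < 1 + 2 * ((2 : ℝ) ^ (-lam) - 1) * (1 / 2) + (1 / 2 : ℝ) ^ (1 - lam) := by
  have h := (strictConcaveOn_rpow_sub_rpow (μ := 1 - lam) (by linarith) (by linarith)).2
    (show (0 : ℝ) ∈ Set.Ici 0 by simp) (show (1 : ℝ) ∈ Set.Ici 0 by simp) zero_ne_one
    (show (0 : ℝ) < 1 / 2 by norm_num) (show (0 : ℝ) < 1 / 2 by norm_num) (by norm_num)
  have h2 : (2 : ℝ) ^ (1 - lam) = 2 * 2 ^ (-lam) := by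
    rw [sub_eq_add_neg, Real.rpow_add (by norm_num), Real.rpow_one]
  simp only [smul_eq_mul, mul_zero, mul_one, zero_add, add_zero, Real.one_rpow,
    Real.zero_rpow (show (1 - lam) ≠ 0 by linarith)] at h
  rw [one_add_one_eq_two, h2] at h
  linarith

theorem rpow_add_le {lam : ℝ} (h0 : 0 < lam) (h1 : lam < 1) {M m : ℝ} (hM : 0 < M) (hm0 : 0 ≤ m)
    (hm : m ≤ M) :
    (M + m) ^ (1 - lam)
      ≤ M ^ (-lam) * (2 * ((2 : ℝ) ^ (-lam) - 1) * m + M) + m ^ (1 - lam) := by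
  have h := rpow_one_add_le h0 h1 (x := m / M) (by positivity) ((div_le_one hM).mpr hm)
  have hMm : M + m = M * (1 + m / M) := by field_simp
  have hp : 0 < M ^ (1 - lam) := by positivity
  have hMl : M ^ (-lam) = M ^ (1 - lam) / M := by
    rw [eq_div_iff hM.ne', sub_eq_neg_add, Real.rpow_add hM, Real.rpow_one]
  rw [hMm, Real.mul_rpow hM.le (by positivity), hMl]
  refine (mul_le_mul_of_nonneg_left h hp.le).trans (le_of_eq ?_)
  rw [Real.div_rpow hm0 hM.le]
  field_simp
  ring

/-- This is `G ≥ 1` with denominators cleared; `rpow_add_le` splits off the leading power, which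
dominates the rest. -/
theorem rpow_binSum_le {lam : ℝ} (h0 : 0 < lam) (h1 : lam < 1) {p : ℕ} {n : Fin p → ℕ}
    (hn : StrictAnti n) :
    (binSum n : ℝ) ^ (1 - lam) ≤ ∑ k, ((2 : ℝ) ^ n k) ^ (-lam) *
      (2 * ((2 : ℝ) ^ (-lam) - 1) * (∑ j ∈ Finset.Ioi k, (2 : ℝ) ^ n j) + 2 ^ n k) := by
  induction p with
  | zero => simp [binSum, Real.zero_rpow (show (1 - lam) ≠ 0 by linarith)]
  | succ p ih =>
    have hle := sum_Ioi_two_pow_le hn 0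
    rw [Fin.sum_univ_succ]
    simp only [Fin.sum_Ioi_succ]
    rw [Fin.sum_Ioi_zero] at hle ⊢
    have h2 := ih (StrictAnti.tail hn)
    rw [cast_binSum] at h2
    rw [cast_binSum, Fin.sum_univ_succ]
    exact (rpow_add_le h0 h1 (by positivity) (by positivity) hle).trans (by gcongr)

theorem G_binVec_eq_div (lam : ℝ) {p : ℕ} (n : Fin (p + 1) → ℕ) :
    G (binVec n) lam = (∑ k, ((2 : ℝ) ^ n k) ^ (-lam) *
      (2 * ((2 : ℝ) ^ (-lam) - 1) * (∑ j ∈ Finset.Ioi k, (2 : ℝ) ^ n j) + 2 ^ n k))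
        / (binSum n : ℝ) ^ (1 - lam) := by
  have hN : (0 : ℝ) < binSum n := by exact_mod_cast binSum_pos n
  rw [G_binVec, Finset.sum_div]
  refine Finset.sum_congr rfl fun k _ => ?_
  have hs : ∑ j ∈ Finset.Ioi k, binVec n j
      = (∑ j ∈ Finset.Ioi k, (2 : ℝ) ^ n j) / (binSum n : ℝ) := (Finset.sum_div _ _ _).symm
  rw [hs, binVec, Real.div_rpow (by positivity) hN.le, sub_eq_neg_add 1 lam, Real.rpow_add hN,
    Real.rpow_one]
  have : (0 : ℝ) < (binSum n : ℝ) ^ (-lam) := by positivity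
  field_simp

theorem one_le_G_binVec {lam : ℝ} (h0 : 0 < lam) (h1 : lam < 1) {p : ℕ} {n : Fin (p + 1) → ℕ}
    (hn : StrictAnti n) : 1 ≤ G (binVec n) lam := by
  have hN : (0 : ℝ) < binSum n := by exact_mod_cast binSum_pos n
  rw [G_binVec_eq_div, one_le_div (by positivity)]
  exact rpow_binSum_le h0 h1 hn

theorem exists_mem_Theta_G_eq_one (lam : ℝ) : ∃ θ ∈ Theta 1, G θ lam = 1 := by
  have hn : StrictAnti (fun _ : Fin 1 => 0) := Subsingleton.strictAnti _
  refine ⟨_, binVec_mem_Theta hn, ?_⟩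
  rw [G_binVec_eq_div]
  simp [binSum]

theorem exists_mem_Theta_one_lt_G {lam : ℝ} (h0 : 0 < lam) (h1 : lam < 1) :
    ∃ θ ∈ Theta 2, 1 < G θ lam := by
  -- Here `N = 3` and the vector is `(2/3, 1/3)`; its ratio `1/2` is interior to the chord, so
  -- concavity is strict there.
  have hn : StrictAnti (![1, 0] : Fin 2 → ℕ) := by
    intro i j hij
    fin_cases i <;> fin_cases j <;> simp_all
  refine ⟨_, binVec_mem_Theta hn, ?_⟩
  rw [G_binVec_eq_div, one_lt_div (by rw [cast_binSum]; positivity)]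
  have h := rpow_one_add_half_lt h0 h1
  have hp : (0 : ℝ) < 2 ^ (1 - lam) := by positivity
  have h3 := mul_lt_mul_of_pos_left h hp
  rw [← Real.mul_rpow (by norm_num) (by norm_num), mul_add ((2 : ℝ) ^ (1 - lam)), ← Real.mul_rpow (by norm_num) (by norm_num)]
    at h3
  have h2 : (2 : ℝ) ^ (1 - lam) = 2 * 2 ^ (-lam) := by
    rw [sub_eq_add_neg, Real.rpow_add (by norm_num), Real.rpow_one]
  rw [h2] at h3
  have hI0 : (Finset.Ioi (0 : Fin 2)) = {1} := by decide
  have hI1 : (Finset.Ioi (1 : Fin 2)) = ∅ := by decide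
  rw [Fin.sum_univ_two, cast_binSum, Fin.sum_univ_two, hI0, hI1]
  simp only [Finset.sum_singleton, Finset.sum_empty, Matrix.cons_val_zero, Matrix.cons_val_one,
    pow_one, pow_zero, Real.one_rpow]
  norm_num at h3 ⊢
  linarith

/-! ### The cosine coefficients of `|2 sin t|^lam` -/

/-- The `2n`-th cosine coefficient of `|2 sin t|^lam` over a period. -/
def cosCoeff (lam : ℝ) (n : ℕ) : ℝ :=
  (1 / Real.pi) * ∫ t in (0)..Real.pi, |2 * Real.sin t| ^ lam * Real.cos (2 * n * t)

theorem continuous_abs_sin_rpow {lam : ℝ} (h0 : 0 ≤ lam) :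
    Continuous fun t : ℝ => |2 * Real.sin t| ^ lam :=
  ((continuous_const.mul Real.continuous_sin).abs).rpow_const fun _ => Or.inr h0

theorem periodic_abs_sin_rpow (lam : ℝ) :
    Function.Periodic (fun t : ℝ => |2 * Real.sin t| ^ lam) Real.pi := fun t => by
  simp only [abs_two_mul_sin_add_pi]

/-- The function `sin^(lam+1) t * cos ((2n+1) t)` vanishes at `0` and `π`, and its derivative
combines two neighbouring integrands. -/
theorem cosCoeff_recurrence {lam : ℝ} (h0 : 0 ≤ lam) (n : ℕ) :
    (lam + 2 * n + 2) * cosCoeff lam (n + 1) = (2 * n - lam) * cosCoeff lam n := by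
  set w : ℝ → ℝ := fun t => |2 * Real.sin t| ^ lam with hw
  have hwc : Continuous w := continuous_abs_sin_rpow h0
  set A : ℝ → ℝ := fun t => w t * Real.cos (2 * n * t) with hA
  set B : ℝ → ℝ := fun t => w t * Real.cos (2 * (n + 1 : ℕ) * t) with hB
  have hAi : IntervalIntegrable A volume 0 Real.pi :=
    (hwc.mul (Real.continuous_cos.comp (by fun_prop))).intervalIntegrable _ _
  have hBi : IntervalIntegrable B volume 0 Real.pi :=
    (hwc.mul (Real.continuous_cos.comp (by fun_prop))).intervalIntegrable _ _
  have hderiv : ∀ t ∈ Set.uIcc 0 Real.pi, HasDerivAt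
      (fun t => (2 : ℝ) ^ lam * (Real.sin t ^ (lam + 1) * Real.cos ((2 * n + 1) * t)))
      ((lam / 2 + n + 1) * B t - (n - lam / 2) * A t) t := by
    intro t ht
    rw [Set.uIcc_of_le Real.pi_pos.le] at ht
    have hs := Real.sin_nonneg_of_mem_Icc ht
    have h1 := (Real.hasDerivAt_sin t).rpow_const (p := lam + 1) (Or.inr (by linarith))
    have h2 := (((hasDerivAt_id t).const_mul (2 * (n : ℝ) + 1))).cos
    refine ((h1.mul h2).const_mul ((2 : ℝ) ^ lam)).congr_deriv ?_
    have h3 : Real.sin t ^ (lam + 1) = Real.sin t ^ lam * Real.sin t := by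
      rw [Real.rpow_add_of_nonneg hs h0 zero_le_one, Real.rpow_one]
    have e1 : (2 * (n : ℝ) * t) = (2 * n + 1) * t - t := by ring
    have e2 : (2 * ((n + 1 : ℕ) : ℝ) * t) = (2 * n + 1) * t + t := by push_cast; ring
    simp only [hA, hB, hw, id]
    rw [e1, e2, Real.cos_sub, Real.cos_add, h3, abs_of_nonneg (by positivity),
      Real.mul_rpow (by norm_num) hs, add_sub_cancel_right]
    ring
  have hint := intervalIntegral.integral_eq_sub_of_hasDerivAt hderiv
    ((hBi.const_mul _).sub (hAi.const_mul _))
  rw [intervalIntegral.integral_sub (hBi.const_mul _) (hAi.const_mul _),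
    intervalIntegral.integral_const_mul, intervalIntegral.integral_const_mul, Real.sin_pi,
    Real.sin_zero, Real.zero_rpow (by linarith)] at hint
  unfold cosCoeff
  linear_combination (2 / Real.pi) * hint

/-- Substitute `x = (1 - cos t) / 2`, for which `x (1 - x) = (sin t / 2)^2`. -/
theorem integral_abs_sin_rpow_eq_betaIntegral (lam : ℝ) :
    ((∫ t in (0)..Real.pi, |2 * Real.sin t| ^ lam : ℝ) : ℂ)
      = (((4 : ℝ) ^ lam : ℝ) : ℂ) * Complex.betaIntegral ((1 + lam) / 2 : ℝ) ((1 + lam) / 2 : ℝ) := by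
  set u : ℝ := (1 + lam) / 2 with hu
  have hbeta : Complex.betaIntegral u u
      = ((∫ x in Set.Ioo (0 : ℝ) 1, x ^ (u - 1) * (1 - x) ^ (u - 1) : ℝ) : ℂ) := by
    rw [Complex.betaIntegral, intervalIntegral.integral_of_le zero_le_one,
      ← integral_Ioc_eq_integral_Ioo, ← integral_complex_ofReal]
    refine setIntegral_congr_fun measurableSet_Ioc fun x hx => ?_
    have h1 : (0 : ℝ) ≤ 1 - x := sub_nonneg.mpr hx.2
    push_cast
    rw [Complex.ofReal_cpow hx.1.le, Complex.ofReal_cpow h1]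
    push_cast
    rfl
  set f : ℝ → ℝ := fun t => (1 - Real.cos t) / 2 with hf
  have himg : f '' Set.Ioo 0 Real.pi = Set.Ioo 0 1 := by
    ext x
    constructor
    · rintro ⟨t, ⟨ht0, ht1⟩, rfl⟩
      have h1 : Real.cos t < 1 := by
        rw [← Real.cos_zero]; exact Real.cos_lt_cos_of_nonneg_of_le_pi le_rfl ht1.le ht0
      have h2 : -1 < Real.cos t := by
        rw [← Real.cos_pi]; exact Real.cos_lt_cos_of_nonneg_of_le_pi ht0.le le_rfl ht1
      simp only [hf]
      constructor <;> linarith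
    · rintro ⟨hx0, hx1⟩
      refine ⟨Real.arccos (1 - 2 * x), ⟨Real.arccos_pos.mpr (by linarith), ?_⟩, ?_⟩
      · refine lt_of_le_of_ne (Real.arccos_le_pi _) fun h => ?_
        have := Real.arccos_eq_pi.mp h
        linarith
      · simp only [hf]
        rw [Real.cos_arccos (by linarith) (by linarith)]
        ring
  have hinj : Set.InjOn f (Set.Ioo 0 Real.pi) := by
    intro x hx y hy hxy
    refine Real.injOn_cos (Set.Ioo_subset_Icc_self hx) (Set.Ioo_subset_Icc_self hy) ?_
    simp only [hf] at hxy
    linarith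
  have hder : ∀ t ∈ Set.Ioo 0 Real.pi,
      HasDerivWithinAt f (Real.sin t / 2) (Set.Ioo 0 Real.pi) t := fun t _ => by
    have h := ((Real.hasDerivAt_cos t).const_sub 1).div_const 2
    rw [neg_neg] at h
    exact h.hasDerivWithinAt
  have hsub := integral_image_eq_integral_abs_deriv_smul measurableSet_Ioo hder hinj
    (fun x => x ^ (u - 1) * (1 - x) ^ (u - 1))
  rw [himg] at hsub
  rw [hbeta, hsub, ← Complex.ofReal_mul, intervalIntegral.integral_of_le Real.pi_pos.le,
    integral_Ioc_eq_integral_Ioo, ← integral_const_mul]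
  congr 1
  refine setIntegral_congr_fun measurableSet_Ioo fun t ht => ?_
  have hs := Real.sin_pos_of_mem_Ioo ht
  have hc1 : 0 ≤ f t ∧ 0 ≤ 1 - f t := by
    simp only [hf]
    constructor <;> linarith [Real.cos_le_one t, Real.neg_one_le_cos t]
  have hprod : f t * (1 - f t) = (Real.sin t / 2) ^ (2 : ℝ) := by
    rw [Real.rpow_two]
    simp only [hf]
    nlinarith [Real.sin_sq_add_cos_sq t]
  simp only [smul_eq_mul]
  rw [← Real.mul_rpow hc1.1 hc1.2, hprod, ← Real.rpow_mul (by positivity), abs_of_pos (by positivity),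
    abs_of_pos (by positivity)]
  have e1 : 2 * (u - 1) = lam - 1 := by rw [hu]; ring
  have e2 : 2 * Real.sin t = 4 * (Real.sin t / 2) := by ring
  rw [e1, e2, Real.mul_rpow (by norm_num) (by positivity), Real.rpow_sub_one (by positivity)]
  field_simp

theorem cosCoeff_zero {lam : ℝ} (h0 : 0 < lam) :
    cosCoeff lam 0 = Real.Gamma (1 + lam) / Real.Gamma (1 + lam / 2) ^ 2 := by
  have h := integral_abs_sin_rpow_eq_betaIntegral lam
  have hu : 0 < (1 + lam) / 2 := by linarith
  rw [Complex.betaIntegral_eq_Gamma_mul_div _ _ (by simpa using hu) (by simpa using hu),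
    ← Complex.ofReal_add, Complex.Gamma_ofReal, Complex.Gamma_ofReal, add_halves] at h
  have h' : ∫ t in (0)..Real.pi, |2 * Real.sin t| ^ lam
      = (4 : ℝ) ^ lam * (Real.Gamma ((1 + lam) / 2) * Real.Gamma ((1 + lam) / 2)
        / Real.Gamma (1 + lam)) := by exact_mod_cast h
  have hdup := Real.Gamma_mul_Gamma_add_half ((1 + lam) / 2)
  have e1 : (1 + lam) / 2 + 1 / 2 = 1 + lam / 2 := by ring
  have e2 : 2 * ((1 + lam) / 2) = 1 + lam := by ring
  have e3 : 1 - (1 + lam) = -lam := by ring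
  rw [e1, e2, e3] at hdup
  have hG1 : 0 < Real.Gamma (1 + lam / 2) := Real.Gamma_pos_of_pos (by linarith)
  have hG2 : 0 < Real.Gamma (1 + lam) := Real.Gamma_pos_of_pos (by linarith)
  have hG3 : Real.Gamma ((1 + lam) / 2)
      = Real.Gamma (1 + lam) * (2 : ℝ) ^ (-lam) * √Real.pi / Real.Gamma (1 + lam / 2) := by
    rw [eq_div_iff hG1.ne', hdup]
  have h4 : (4 : ℝ) ^ lam = 2 ^ lam * 2 ^ lam := by
    rw [← Real.mul_rpow (by norm_num) (by norm_num)]; norm_num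
  have h2 : (2 : ℝ) ^ (-lam) = ((2 : ℝ) ^ lam)⁻¹ := Real.rpow_neg (by norm_num) _
  have hpi := Real.mul_self_sqrt Real.pi_pos.le
  simp only [cosCoeff, Nat.cast_zero, mul_zero, zero_mul, Real.cos_zero, mul_one]
  rw [h', hG3, h4, h2]
  have : (0 : ℝ) < 2 ^ lam := by positivity
  field_simp
  rw [Real.sq_sqrt Real.pi_pos.le]

theorem integral_sigma1 {f : Circle → ℝ} (hf : Continuous f) :
    ∫ x, f x ∂sigma1 = (1 / (2 * Real.pi)) * ∫ t in (0)..(2 * Real.pi), f (Circle.exp t) := by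
  rw [sigma1, integral_smul_measure, integral_map Circle.exp.continuous.measurable.aemeasurable
    hf.measurable.aestronglyMeasurable, intervalIntegral.integral_of_le Real.two_pi_pos.le,
    ENNReal.toReal_inv, ENNReal.toReal_ofReal Real.two_pi_pos.le, smul_eq_mul, one_div]

/-- By periodicity the inner integral does not depend on the point, so it is already the energy. -/
theorem contEnergy_sigma1 {lam : ℝ} (h0 : 0 ≤ lam) :
    contEnergy lam sigma1 = cosCoeff lam 0 := by
  have hinner : ∀ x : Circle, ∫ y, ‖(x : ℂ) - (y : ℂ)‖ ^ lam ∂sigma1 = cosCoeff lam 0 := by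
    intro x
    obtain ⟨s, rfl⟩ := Circle.exp_surjective x
    rw [integral_sigma1 (f := fun y : Circle => ‖(Circle.exp s : ℂ) - (y : ℂ)‖ ^ lam)
      (((continuous_const.sub continuous_subtype_val).norm).rpow_const fun _ => Or.inr h0)]
    simp only [norm_exp_sub_exp, sub_div]
    rw [intervalIntegral.integral_comp_sub_div (fun t => |2 * Real.sin t| ^ lam) two_ne_zero]
    have hper := (periodic_abs_sin_rpow lam).intervalIntegral_add_eq (s / 2 - Real.pi) 0
    rw [zero_add, sub_add_cancel] at hper
    rw [mul_div_cancel_left₀ _ two_ne_zero, zero_div, sub_zero, hper]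
    simp only [cosCoeff, Nat.cast_zero, mul_zero, zero_mul, Real.cos_zero, mul_one, smul_eq_mul]
    field_simp
  simp only [contEnergy, hinner]
  rw [integral_sigma1 (f := fun _ => cosCoeff lam 0) continuous_const,
    intervalIntegral.integral_const, smul_eq_mul, sub_zero]
  field_simp

/-! ### Asymptotics of the cosine coefficients -/

theorem cosCoeff_succ_eq_prod {lam : ℝ} (h0 : 0 < lam) (n : ℕ) :
    cosCoeff lam (n + 1) * ∏ j ∈ Finset.range (n + 1), (1 + lam / 2 + j)
      = cosCoeff lam 0 * ∏ j ∈ Finset.range (n + 1), (-(lam / 2) + j) := by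
  have hrec : ∀ k : ℕ, (1 + lam / 2 + k) * cosCoeff lam (k + 1)
      = (-(lam / 2) + k) * cosCoeff lam k := fun k => by
    linear_combination (1 / 2) * cosCoeff_recurrence h0.le k
  have h : ∀ k : ℕ, cosCoeff lam k * ∏ j ∈ Finset.range k, (1 + lam / 2 + j)
      = cosCoeff lam 0 * ∏ j ∈ Finset.range k, (-(lam / 2) + (j : ℝ)) := by
    intro k
    induction k with
    | zero => simp
    | succ k ih =>
      rw [Finset.prod_range_succ, Finset.prod_range_succ]
      linear_combination (∏ j ∈ Finset.range k, (1 + lam / 2 + (j : ℝ))) * hrec k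
        + (-(lam / 2) + k) * ih
  exact h (n + 1)

/-- The limit of `n^(1 + lam)` times the `2n`-th cosine coefficient. -/
def cosCoeffLimit (lam : ℝ) : ℝ :=
  -(Real.Gamma (1 + lam) * Real.sin (Real.pi * (lam / 2)) / Real.pi)

/-- The unrolled recurrence is a quotient of two Euler sequences for Gamma, and the reflection
formula rewrites its limit. The index is `n + 1` because `Real.GammaSeq _ n` has `n + 1` factors. -/
theorem tendsto_rpow_mul_cosCoeff_succ {lam : ℝ} (h0 : 0 < lam) (h1 : lam < 1) :
    Tendsto (fun n : ℕ => (n : ℝ) ^ (1 + lam) * cosCoeff lam (n + 1)) atTop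
      (𝓝 (cosCoeffLimit lam)) := by
  have hs : ∀ m : ℕ, -(lam / 2) ≠ -(m : ℝ) := fun m h => by
    rcases Nat.eq_zero_or_pos m with rfl | hm
    · simp at h; linarith
    · have : (1 : ℝ) ≤ m := by exact_mod_cast hm
      linarith
  have hG : Real.Gamma (-(lam / 2)) ≠ 0 := Real.Gamma_ne_zero hs
  have hlim : cosCoeffLimit lam
      = cosCoeff lam 0 * (Real.Gamma (1 + lam / 2) / Real.Gamma (-(lam / 2))) := by
    have hrefl := Real.Gamma_mul_Gamma_one_sub (-(lam / 2))
    rw [sub_neg_eq_add, mul_neg, Real.sin_neg] at hrefl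
    have hsin : 0 < Real.sin (Real.pi * (lam / 2)) :=
      Real.sin_pos_of_pos_of_lt_pi (by positivity) (by nlinarith [Real.pi_pos])
    have hG1 : 0 < Real.Gamma (1 + lam / 2) := Real.Gamma_pos_of_pos (by linarith)
    rw [cosCoeff_zero h0, cosCoeffLimit]
    rw [div_neg, eq_neg_iff_add_eq_zero] at hrefl
    generalize Real.Gamma (1 + lam / 2) = g at *
    generalize Real.Gamma (-(lam / 2)) = g' at *
    generalize Real.sin (Real.pi * (lam / 2)) = σ at *
    field_simp at hrefl ⊢
    linear_combination -hrefl
  rw [hlim]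
  refine (((Real.GammaSeq_tendsto_Gamma (1 + lam / 2)).div
    (Real.GammaSeq_tendsto_Gamma (-(lam / 2))) hG).const_mul (cosCoeff lam 0)).congr' ?_
  filter_upwards [eventually_gt_atTop 0] with n hn
  have hn' : (0 : ℝ) < n := by exact_mod_cast hn
  have hprod := cosCoeff_succ_eq_prod h0 n
  have hA : ∏ j ∈ Finset.range (n + 1), (1 + lam / 2 + (j : ℝ)) ≠ 0 :=
    Finset.prod_ne_zero_iff.mpr fun j _ => by positivity
  have hB : ∏ j ∈ Finset.range (n + 1), (-(lam / 2) + (j : ℝ)) ≠ 0 :=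
    Finset.prod_ne_zero_iff.mpr fun j _ h => hs j (by linarith)
  have hfac : (0 : ℝ) < n.factorial := by positivity
  have hpow : (n : ℝ) ^ (1 + lam) * (n : ℝ) ^ (-(lam / 2)) = (n : ℝ) ^ (1 + lam / 2) := by
    rw [← Real.rpow_add hn']; congr 1; ring
  have hp : (0 : ℝ) < (n : ℝ) ^ (-(lam / 2)) := by positivity
  simp only [Pi.div_apply, Real.GammaSeq]
  rw [← hpow]
  generalize ∏ j ∈ Finset.range (n + 1), (1 + lam / 2 + (j : ℝ)) = A at *
  generalize ∏ j ∈ Finset.range (n + 1), (-(lam / 2) + (j : ℝ)) = B at *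
  field_simp
  linear_combination -hprod

theorem tendsto_rpow_mul_cosCoeff {lam : ℝ} (h0 : 0 < lam) (h1 : lam < 1) :
    Tendsto (fun n : ℕ => (n : ℝ) ^ (1 + lam) * cosCoeff lam n) atTop (𝓝 (cosCoeffLimit lam)) := by
  have hratio : Tendsto (fun n : ℕ => ((1 + lam / 2) + (1 : ℝ) * n) / (-(lam / 2) + 1 * n)) atTop
      (𝓝 (1 / 1)) := tendsto_add_mul_div_add_mul_atTop_nhds _ _ _ one_ne_zero
  have h := (tendsto_rpow_mul_cosCoeff_succ h0 h1).mul hratio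
  rw [div_one, mul_one] at h
  refine h.congr' ?_
  filter_upwards [eventually_gt_atTop 0] with n hn
  have hn' : (1 : ℝ) ≤ n := by exact_mod_cast hn
  have hne : -(lam / 2) + 1 * (n : ℝ) ≠ 0 := by linarith
  rw [mul_div_assoc', div_eq_iff hne]
  linear_combination ((n : ℝ) ^ (1 + lam) / 2) * cosCoeff_recurrence h0.le n

/-! ### Fourier expansion and the energy of roots of unity -/

theorem integral_abs_sin_rpow_mul_sin (lam : ℝ) (n : ℤ) :
    ∫ t in (0)..Real.pi, |2 * Real.sin t| ^ lam * Real.sin (2 * n * t) = 0 := by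
  have h := intervalIntegral.integral_comp_sub_left
    (fun t => |2 * Real.sin t| ^ lam * Real.sin (2 * n * t)) Real.pi (a := 0) (b := Real.pi)
  have h2 : ∀ t : ℝ, |2 * Real.sin (Real.pi - t)| ^ lam * Real.sin (2 * n * (Real.pi - t))
      = -(|2 * Real.sin t| ^ lam * Real.sin (2 * n * t)) := fun t => by
    have e : 2 * (n : ℝ) * (Real.pi - t) = n * (2 * Real.pi) - 2 * n * t := by ring
    rw [Real.sin_pi_sub, e, Real.sin_int_mul_two_pi_sub, mul_neg]
  simp only [h2, intervalIntegral.integral_neg, sub_self, sub_zero] at h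
  linarith

theorem integral_abs_sin_rpow_mul_cos (lam : ℝ) (n : ℤ) :
    (1 / Real.pi) * ∫ t in (0)..Real.pi, |2 * Real.sin t| ^ lam * Real.cos (2 * n * t)
      = cosCoeff lam n.natAbs := by
  unfold cosCoeff
  congr 2
  ext t
  congr 1
  have h : ((n.natAbs : ℕ) : ℝ) = |(n : ℝ)| := by
    rw [← Int.cast_abs, Int.abs_eq_natAbs, Int.cast_natCast]
  rw [h]
  rcases abs_choice (n : ℝ) with h | h <;> rw [h]
  rw [mul_neg, neg_mul, Real.cos_neg]

theorem summable_cosCoeff_natAbs {lam : ℝ} (h0 : 0 < lam) (h1 : lam < 1) :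
    Summable fun n : ℤ => cosCoeff lam n.natAbs := by
  obtain ⟨B, hB⟩ : ∃ B, ∀ n : ℕ, |(n : ℝ) ^ (1 + lam) * cosCoeff lam n| ≤ B := by
    obtain ⟨B, hB⟩ := (Metric.isBounded_range_of_tendsto _
      (tendsto_rpow_mul_cosCoeff h0 h1)).exists_norm_le
    exact ⟨B, fun q => hB _ (Set.mem_range_self q)⟩
  refine summable_of_isBigO ((Real.summable_abs_int_rpow (b := 1 + lam) (by linarith))) ?_
  refine Asymptotics.IsBigO.of_bound B ?_
  have hne : ∀ᶠ n : ℤ in cofinite, n ≠ 0 := (Set.finite_singleton (0 : ℤ)).compl_mem_cofinite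
  filter_upwards [hne] with n hn
  have h : ((n.natAbs : ℕ) : ℝ) = |(n : ℝ)| := by
    rw [← Int.cast_abs, Int.abs_eq_natAbs, Int.cast_natCast]
  have hpos : 0 < |(n : ℝ)| := abs_pos.mpr (by exact_mod_cast hn)
  have h2 := hB n.natAbs
  rw [h, abs_mul, abs_of_pos (Real.rpow_pos_of_pos hpos _)] at h2
  rw [Real.norm_eq_abs, Real.norm_eq_abs, abs_of_pos (Real.rpow_pos_of_pos hpos _),
    Real.rpow_neg hpos.le, ← div_eq_mul_inv, le_div_iff₀ (Real.rpow_pos_of_pos hpos _), mul_comm]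
  exact h2

/-- Fourier series on the circle of length `π`. The sine parts vanish under `t ↦ π - t`, and
summable coefficients give pointwise convergence. -/
theorem hasSum_cosCoeff_mul_exp {lam : ℝ} (h0 : 0 < lam) (h1 : lam < 1) (x : ℝ) :
    HasSum (fun n : ℤ => (cosCoeff lam n.natAbs : ℂ) * Complex.exp (2 * n * x * Complex.I))
      ((|2 * Real.sin x| ^ lam : ℝ) : ℂ) := by
  have : Fact (0 < Real.pi) := ⟨Real.pi_pos⟩
  have hper : Function.Periodic (fun t : ℝ => ((|2 * Real.sin t| ^ lam : ℝ) : ℂ)) Real.pi :=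
    fun t => congrArg _ (periodic_abs_sin_rpow lam t)
  have hcont : Continuous hper.lift :=
    continuous_coinduced_dom.mpr (Complex.continuous_ofReal.comp (continuous_abs_sin_rpow h0.le))
  let f : C(AddCircle Real.pi, ℂ) := ⟨hper.lift, hcont⟩
  have hf : ∀ t : ℝ, f (t : AddCircle Real.pi) = ((|2 * Real.sin t| ^ lam : ℝ) : ℂ) :=
    fun t => hper.lift_coe t
  have hexp : ∀ (n : ℤ) (t : ℝ), fourier n (t : AddCircle Real.pi)
      = Complex.exp (2 * n * t * Complex.I) := fun n t => by
    rw [fourier_coe_apply]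
    congr 1
    have : (Real.pi : ℂ) ≠ 0 := by exact_mod_cast Real.pi_ne_zero
    field_simp
  have hcoeff : ∀ n : ℤ, fourierCoeff f n = (cosCoeff lam n.natAbs : ℂ) := by
    intro n
    rw [fourierCoeff_eq_intervalIntegral f n 0, zero_add]
    have hint : ∀ t : ℝ, fourier (-n) (t : AddCircle Real.pi) • f (t : AddCircle Real.pi)
        = ((|2 * Real.sin t| ^ lam * Real.cos (2 * n * t) : ℝ) : ℂ)
          - ((|2 * Real.sin t| ^ lam * Real.sin (2 * n * t) : ℝ) : ℂ) * Complex.I := fun t => by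
      rw [hexp, hf, Complex.exp_mul_I, smul_eq_mul]
      push_cast
      rw [mul_neg, neg_mul, Complex.cos_neg, Complex.sin_neg]
      ring
    have hw := continuous_abs_sin_rpow h0.le
    have hc1 : Continuous fun t : ℝ => |2 * Real.sin t| ^ lam * Real.cos (2 * n * t) :=
      hw.mul (Real.continuous_cos.comp (by fun_prop))
    have hc2 : Continuous fun t : ℝ => |2 * Real.sin t| ^ lam * Real.sin (2 * n * t) :=
      hw.mul (Real.continuous_sin.comp (by fun_prop))
    simp only [hint]
    have hi1 : IntervalIntegrable
        (fun t : ℝ => ((|2 * Real.sin t| ^ lam * Real.cos (2 * n * t) : ℝ) : ℂ)) volume 0 Real.pi :=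
      (Complex.continuous_ofReal.comp hc1).intervalIntegrable _ _
    have hi2 : IntervalIntegrable
        (fun t : ℝ => ((|2 * Real.sin t| ^ lam * Real.sin (2 * n * t) : ℝ) : ℂ) * Complex.I)
        volume 0 Real.pi :=
      ((Complex.continuous_ofReal.comp hc2).mul continuous_const).intervalIntegrable _ _
    rw [intervalIntegral.integral_sub hi1 hi2,
      intervalIntegral.integral_mul_const, intervalIntegral.integral_ofReal,
      intervalIntegral.integral_ofReal, integral_abs_sin_rpow_mul_sin,
      ← integral_abs_sin_rpow_mul_cos]
    simp
  have hsum : Summable (fourierCoeff f) := by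
    simp only [funext hcoeff]
    exact Complex.hasSum_ofReal.mpr (summable_cosCoeff_natAbs h0 h1).hasSum |>.summable
  have h := has_pointwise_sum_fourier_series_of_summable hsum (x : AddCircle Real.pi)
  simp only [hcoeff, hexp, hf, smul_eq_mul] at h
  exact h

theorem sum_exp_range {M : ℕ} (hM : 0 < M) (n : ℤ) :
    ∑ k ∈ Finset.range M, Complex.exp (2 * n * (Real.pi * k / M : ℝ) * Complex.I)
      = if (M : ℤ) ∣ n then (M : ℂ) else 0 := by
  have hM' : (M : ℂ) ≠ 0 := by exact_mod_cast hM.ne'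
  have hpi : (2 * Real.pi * Complex.I : ℂ) ≠ 0 := Complex.two_pi_I_ne_zero
  set z := Complex.exp (2 * Real.pi * Complex.I * n / M) with hz
  have hterm : ∀ k : ℕ, Complex.exp (2 * n * (Real.pi * k / M : ℝ) * Complex.I) = z ^ k := fun k => by
    rw [hz, ← Complex.exp_nat_mul]
    congr 1
    push_cast
    ring
  simp only [hterm]
  have hz1 : z = 1 ↔ (M : ℤ) ∣ n := by
    rw [hz, Complex.exp_eq_one_iff]
    constructor
    · rintro ⟨m, hm⟩
      refine ⟨m, ?_⟩
      rw [div_eq_iff hM'] at hm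
      have : (n : ℂ) = M * m := mul_left_cancel₀ hpi (by linear_combination hm)
      exact_mod_cast this
    · rintro ⟨m, rfl⟩
      refine ⟨m, ?_⟩
      push_cast
      field_simp
  split_ifs with h
  · rw [hz1.mpr h]; simp
  · have hzM : z ^ M = 1 := by
      rw [hz, ← Complex.exp_nat_mul, Complex.exp_eq_one_iff]
      exact ⟨n, by field_simp⟩
    have hg := geom_sum_mul z M
    rw [hzM, sub_self] at hg
    exact (mul_eq_zero.mp hg).resolve_right (sub_ne_zero.mpr fun h' => h (hz1.mp h'))

/-- Aliasing: averaging over `M` equally spaced points keeps only the frequencies divisible by `M`.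
-/
theorem hasSum_cosCoeff_multiples {lam : ℝ} (h0 : 0 < lam) (h1 : lam < 1) {M : ℕ} (hM : 0 < M) :
    HasSum (fun j : ℕ => 2 * cosCoeff lam (M * (j + 1)))
      (rootPotential lam M 0 / M - cosCoeff lam 0) := by
  have hMr : (M : ℝ) ≠ 0 := by positivity
  have hMc : (M : ℂ) ≠ 0 := by exact_mod_cast hM.ne'
  have h := hasSum_sum (s := Finset.range M)
    fun k _ => hasSum_cosCoeff_mul_exp h0 h1 (Real.pi * k / M)
  simp only [← Finset.mul_sum, sum_exp_range hM] at h
  rw [← Complex.ofReal_sum] at h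
  have hinj : Function.Injective fun j : ℤ => (M : ℤ) * j :=
    mul_right_injective₀ (by exact_mod_cast hM.ne')
  rw [← hinj.hasSum_iff (fun n hn => by
    rw [if_neg fun ⟨m, hm⟩ => hn ⟨m, hm.symm⟩, mul_zero])] at h
  have h2 : HasSum (fun j : ℤ => cosCoeff lam (M * j.natAbs)) (rootPotential lam M 0 / M) := by
    rw [← Complex.hasSum_ofReal]
    have h3 := h.div_const (M : ℂ)
    simp only [Function.comp_def, dvd_mul_right, if_true, Int.natAbs_mul, Int.natAbs_natCast,
      mul_div_cancel_right₀ _ hMc] at h3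
    have e : ((rootPotential lam M 0 / M : ℝ) : ℂ)
        = ((∑ k ∈ Finset.range M, |2 * Real.sin (Real.pi * k / M)| ^ lam : ℝ) : ℂ) / M := by
      rw [Complex.ofReal_div, Complex.ofReal_natCast]
      simp only [rootPotential, zero_add]
    rw [e]
    exact h3
  have h4 := h2.nat_add_neg
  simp only [Int.natAbs_neg, Int.natAbs_natCast, Int.natAbs_zero, mul_zero] at h4
  have h5 := (hasSum_nat_add_iff' 1).mpr h4
  simp only [Finset.sum_range_one, mul_zero] at h5
  have e : rootPotential lam M 0 / M - cosCoeff lam 0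
      = rootPotential lam M 0 / M + cosCoeff lam 0 - (cosCoeff lam 0 + cosCoeff lam 0) := by ring
  rw [e]
  simp only [two_mul]
  exact h5

theorem tendsto_rootPotential {lam : ℝ} (h0 : 0 < lam) (h1 : lam < 1) :
    Tendsto (fun M : ℕ => (M : ℝ) ^ lam * (rootPotential lam M 0 - M * cosCoeff lam 0)) atTop
      (𝓝 (2 * cosCoeffLimit lam * ∑' n : ℕ, 1 / ((n : ℝ) + 1) ^ (1 + lam))) := by
  obtain ⟨B, hB⟩ : ∃ B, ∀ n : ℕ, |(n : ℝ) ^ (1 + lam) * cosCoeff lam n| ≤ B := by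
    obtain ⟨B, hB⟩ := (Metric.isBounded_range_of_tendsto _
      (tendsto_rpow_mul_cosCoeff h0 h1)).exists_norm_le
    exact ⟨B, fun q => hB _ (Set.mem_range_self q)⟩
  have hsum : Summable fun n : ℕ => 1 / ((n : ℝ) + 1) ^ (1 + lam) := by
    have := (summable_nat_add_iff 1).mpr
      (Real.summable_one_div_nat_rpow (p := 1 + lam).mpr (by linarith))
    simpa using this
  have hterm : ∀ M j : ℕ, (M : ℝ) ^ (1 + lam) * (2 * cosCoeff lam (M * (j + 1)))
      = (1 / ((j : ℝ) + 1) ^ (1 + lam)) * (2 * (((M * (j + 1) : ℕ) : ℝ) ^ (1 + lam)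
        * cosCoeff lam (M * (j + 1)))) := fun M j => by
    have hj : (0 : ℝ) < ((j : ℝ) + 1) ^ (1 + lam) := by positivity
    rw [Nat.cast_mul, Nat.cast_add_one, Real.mul_rpow (by positivity) (by positivity)]
    field_simp
  have h := tendsto_tsum_of_dominated_convergence (𝓕 := atTop)
    (f := fun M j : ℕ => (M : ℝ) ^ (1 + lam) * (2 * cosCoeff lam (M * (j + 1))))
    (g := fun j : ℕ => 1 / ((j : ℝ) + 1) ^ (1 + lam) * (2 * cosCoeffLimit lam))
    (bound := fun j : ℕ => 1 / ((j : ℝ) + 1) ^ (1 + lam) * (2 * B)) (hsum.mul_right _)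
    (fun j => by
      simp only [hterm]
      exact (((tendsto_rpow_mul_cosCoeff h0 h1).comp
        (tendsto_id.atTop_mul_const' (Nat.succ_pos j))).const_mul 2).const_mul _)
    (Eventually.of_forall fun M j => by
      rw [hterm, norm_mul, Real.norm_eq_abs, Real.norm_eq_abs, abs_of_nonneg (by positivity),
        abs_mul, abs_two]
      gcongr
      exact hB _)
  rw [tsum_mul_right, mul_comm] at h
  refine h.congr' ?_
  filter_upwards [eventually_gt_atTop 0] with M hM
  have hM' : (0 : ℝ) < M := by exact_mod_cast hM
  rw [((hasSum_cosCoeff_multiples h0 h1 hM).mul_left _).tsum_eq, add_comm 1 lam,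
    Real.rpow_add hM', Real.rpow_one]
  field_simp

/-- The functional equation at `s = 1 + lam`, with `cos (π (1 + lam) / 2) = -sin (π lam / 2)`. -/
theorem cosCoeffLimit_mul_zeta {lam : ℝ} (h0 : 0 < lam) :
    2 * cosCoeffLimit lam * ∑' n : ℕ, 1 / ((n : ℝ) + 1) ^ (1 + lam)
      = (2 * Real.pi) ^ lam * (2 * zetaReal (-lam)) := by
  have hz : riemannZeta ((1 + lam : ℝ) : ℂ)
      = ((∑' n : ℕ, 1 / ((n : ℝ) + 1) ^ (1 + lam) : ℝ) : ℂ) := by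
    rw [zeta_eq_tsum_one_div_nat_add_one_cpow (by simpa using h0), Complex.ofReal_tsum]
    refine tsum_congr fun n => ?_
    rw [Complex.ofReal_div, Complex.ofReal_one, Complex.ofReal_cpow (by positivity)]
    push_cast
    rfl
  have hfe := riemannZeta_one_sub (s := ((1 + lam : ℝ) : ℂ)) (fun n h => by
      have : (1 + lam : ℝ) = -(n : ℝ) := by exact_mod_cast h
      have hn : (0 : ℝ) ≤ n := Nat.cast_nonneg n
      linarith) (fun h => by
      have : (1 + lam : ℝ) = 1 := by exact_mod_cast h
      linarith)
  have e1 : (1 : ℂ) - ((1 + lam : ℝ) : ℂ) = ((-lam : ℝ) : ℂ) := by push_cast; ring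
  have e2 : (2 * (Real.pi : ℂ)) ^ (-((1 + lam : ℝ) : ℂ))
      = (((2 * Real.pi) ^ (-(1 + lam)) : ℝ) : ℂ) := by
    rw [Complex.ofReal_cpow Real.two_pi_pos.le]; push_cast; rfl
  have e3 : Complex.cos (Real.pi * ((1 + lam : ℝ) : ℂ) / 2)
      = ((-Real.sin (Real.pi * (lam / 2)) : ℝ) : ℂ) := by
    rw [← Real.cos_add_pi_div_two, Complex.ofReal_cos]
    congr 1
    push_cast
    ring
  rw [e1, e2, e3, hz, Complex.Gamma_ofReal, ← ofReal_zetaReal] at hfe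
  have hr : zetaReal (-lam) = 2 * (2 * Real.pi) ^ (-(1 + lam)) * Real.Gamma (1 + lam)
      * (-Real.sin (Real.pi * (lam / 2))) * ∑' n : ℕ, 1 / ((n : ℝ) + 1) ^ (1 + lam) := by
    exact_mod_cast hfe
  have hp : (0 : ℝ) < (2 * Real.pi) ^ lam := by positivity
  rw [hr, cosCoeffLimit, Real.rpow_neg Real.two_pi_pos.le, Real.rpow_add Real.two_pi_pos,
    Real.rpow_one]
  field_simp

theorem tendsto_dyadicRemainder {lam : ℝ} (h0 : 0 < lam) (h1 : lam < 1) :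
    Tendsto (dyadicRemainder lam) atTop (𝓝 ((2 * Real.pi) ^ lam * (2 * zetaReal (-lam)))) := by
  rw [← cosCoeffLimit_mul_zeta h0]
  refine ((tendsto_rootPotential h0 h1).comp
    (tendsto_pow_atTop_atTop_of_one_lt (r := 2) (by norm_num))).congr fun q => ?_
  simp only [Function.comp, dyadicRemainder, contEnergy_sigma1 h0.le]
  push_cast
  rfl

theorem two_pi_rpow_mul_zetaReal_neg {lam : ℝ} (h0 : 0 < lam) (h1 : lam < 1) :
    (2 * Real.pi) ^ lam * (2 * zetaReal (-lam)) < 0 := by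
  rw [← cosCoeffLimit_mul_zeta h0]
  have hsum : Summable fun n : ℕ => 1 / ((n : ℝ) + 1) ^ (1 + lam) := by
    have := (summable_nat_add_iff 1).mpr
      (Real.summable_one_div_nat_rpow (p := 1 + lam).mpr (by linarith))
    simpa using this
  have hpos : 0 < ∑' n : ℕ, 1 / ((n : ℝ) + 1) ^ (1 + lam) :=
    hsum.tsum_pos (fun n => by positivity) 0 (by positivity)
  have hsin : 0 < Real.sin (Real.pi * (lam / 2)) :=
    Real.sin_pos_of_pos_of_lt_pi (by positivity) (by nlinarith [Real.pi_pos])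
  have hG : 0 < Real.Gamma (1 + lam) := Real.Gamma_pos_of_pos (by linarith)
  have : cosCoeffLimit lam < 0 := neg_lt_zero.mpr (by positivity)
  nlinarith

/-! ### Upper and lower limits -/

theorem limsup_eq_of_le_add_of_tendsto_comp {u d : ℕ → ℝ} {c : ℝ} (hb : ∃ C, ∀ N, |u N| ≤ C)
    (hd : Tendsto d atTop (𝓝 0)) (hle : ∀ᶠ N in atTop, u N ≤ c + d N) {φ : ℕ → ℕ}
    (hφ : StrictMono φ) (ht : Tendsto (fun m => u (φ m)) atTop (𝓝 c)) :
    limsup u atTop = c := by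
  obtain ⟨C, hC⟩ := hb
  have hbdd : IsBoundedUnder (· ≤ ·) atTop u := isBoundedUnder_of ⟨C, fun N => (abs_le.mp (hC N)).2⟩
  have hcob : IsCoboundedUnder (· ≤ ·) atTop u :=
    (isBoundedUnder_of ⟨-C, fun N => (abs_le.mp (hC N)).1⟩ :
      IsBoundedUnder (· ≥ ·) atTop u).isCoboundedUnder_le
  refine le_antisymm ?_ ?_
  · refine le_of_forall_pos_le_add fun ε hε => limsup_le_of_le hcob ?_
    filter_upwards [hle, hd.eventually (gt_mem_nhds hε)] with N h1 h2
    linarith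
  · refine le_of_forall_pos_sub_le fun ε hε => le_limsup_of_frequently_le ?_ hbdd
    have h : ∀ᶠ m in atTop, c - ε ≤ u (φ m) :=
      (ht.eventually (lt_mem_nhds (sub_lt_self c hε))).mono fun _ h => h.le
    exact hφ.tendsto_atTop.frequently h.frequently

/-- Limit points merely close to `c` suffice, so the supremum of `G` need not be attained. -/
theorem liminf_eq_of_add_le_of_tendsto_comp {u d : ℕ → ℝ} {c : ℝ} (hb : ∃ C, ∀ N, |u N| ≤ C)
    (hd : Tendsto d atTop (𝓝 0)) (hle : ∀ᶠ N in atTop, c + d N ≤ u N)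
    (ht : ∀ ε > 0, ∃ (l : ℝ) (φ : ℕ → ℕ), l < c + ε ∧ StrictMono φ ∧
      Tendsto (fun m => u (φ m)) atTop (𝓝 l)) :
    liminf u atTop = c := by
  obtain ⟨C, hC⟩ := hb
  have hbdd : IsBoundedUnder (· ≥ ·) atTop u :=
    isBoundedUnder_of ⟨-C, fun N => (abs_le.mp (hC N)).1⟩
  have hcob : IsCoboundedUnder (· ≥ ·) atTop u :=
    (isBoundedUnder_of ⟨C, fun N => (abs_le.mp (hC N)).2⟩ :
      IsBoundedUnder (· ≤ ·) atTop u).isCoboundedUnder_ge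
  refine le_antisymm ?_ ?_
  · refine le_of_forall_pos_le_add fun ε hε => liminf_le_of_frequently_le ?_ hbdd
    obtain ⟨l, φ, hl, hφ, h⟩ := ht ε hε
    exact hφ.tendsto_atTop.frequently
      ((h.eventually (gt_mem_nhds hl)).mono fun _ h => h.le).frequently
  · refine le_of_forall_pos_sub_le fun ε hε => le_liminf_of_le hcob ?_
    filter_upwards [hle, hd.eventually (lt_mem_nhds (neg_lt_zero.mpr hε))] with N h1 h2
    linarith

theorem isLUB_gBar {lam : ℝ} (h0 : 0 < lam) (h1 : lam < 1) :
    IsLUB {x : ℝ | ∃ p : ℕ, 1 ≤ p ∧ ∃ θ ∈ Theta p, x = G θ lam} (gBar lam) := by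
  set B := (1 - (2 : ℝ) ^ (-(1 - lam)))⁻¹ * 3 with hB
  have hB0 : 0 ≤ B := by
    have := two_rpow_neg_lt_one h1
    have : 0 < 1 - (2 : ℝ) ^ (-(1 - lam)) := by linarith
    positivity
  have hG : ∀ p : ℕ, 1 ≤ p → ∀ θ ∈ Theta p, G θ lam ≤ B := fun p hp θ hθ =>
    (le_abs_self _).trans (abs_G_le_of_mem_Theta h0 h1 hp hθ)
  constructor
  · rintro x ⟨p, hp, θ, hθ, rfl⟩
    have hbdd : BddAbove (Set.range fun p : ℕ+ => gBarP p lam) := by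
      refine ⟨B, ?_⟩
      rintro _ ⟨p, rfl⟩
      refine Real.sSup_le ?_ hB0
      rintro _ ⟨θ, hθ, rfl⟩
      exact hG p p.2 θ hθ
    refine le_trans ?_ (le_ciSup hbdd ⟨p, hp⟩)
    refine le_csSup ⟨B, ?_⟩ ⟨θ, hθ, rfl⟩
    rintro _ ⟨θ, hθ, rfl⟩
    exact hG p hp θ hθ
  · intro b hb
    obtain ⟨θ, hθ, hθ1⟩ := exists_mem_Theta_G_eq_one lam
    -- `Real.sSup_le` requires a nonnegative bound because the real supremum of the empty set is
    -- `0`; the value `1` of `G` supplies it.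
    have hb0 : 0 ≤ b := zero_le_one.trans (hθ1 ▸ hb ⟨1, le_rfl, θ, hθ, rfl⟩)
    refine ciSup_le fun p => Real.sSup_le ?_ hb0
    rintro _ ⟨θ, hθ, rfl⟩
    exact hb ⟨p, p.2, θ, hθ, rfl⟩

theorem IsGreedy.exists_tendsto_secondOrder {lam : ℝ} (h0 : 0 < lam) (h1 : lam < 1)
    {a : ℕ → Circle} (ha : IsGreedy lam a) {p : ℕ} {θ : Fin p → ℝ} (hθ : θ ∈ Theta p) :
    ∃ φ : ℕ → ℕ, StrictMono φ ∧ Tendsto (fun m => secondOrder lam a (φ m)) atTop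
      (𝓝 (G θ lam * ((2 * Real.pi) ^ lam * (2 * zetaReal (-lam))))) := by
  obtain ⟨n, hn, hmono, ht⟩ := hθ
  refine ⟨_, hmono, ?_⟩
  set c := (2 * Real.pi) ^ lam * (2 * zetaReal (-lam))
  have hG := (tendsto_G_binVec h0 h1 hn ht).mul_const c
  have hdiff : Tendsto (fun m => secondOrder lam a (binSum (n m)) - G (binVec (n m)) lam * c)
      atTop (𝓝 0) := by
    rw [Metric.tendsto_atTop]
    intro ε hε
    obtain ⟨N₀, hN₀⟩ := exists_abs_secondOrder_sub_le h0 h1 ha (tendsto_dyadicRemainder h0 h1)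
      (half_pos hε)
    refine ⟨N₀, fun m hm => ?_⟩
    rw [Real.dist_eq, sub_zero]
    exact (hN₀ p (n m) (hn m) (hm.trans (hmono.le_apply))).trans_lt (half_lt_self hε)
  simpa using hdiff.add hG

theorem IsGreedy.exists_secondOrder_eq {lam : ℝ} (h0 : 0 < lam) (h1 : lam < 1)
    {a : ℕ → Circle} (ha : IsGreedy lam a) :
    ∃ g d : ℕ → ℝ, Tendsto d atTop (𝓝 0) ∧
      (∀ N, 0 < N → 1 ≤ g N ∧ ∃ p : ℕ, 1 ≤ p ∧ ∃ θ ∈ Theta p, g N = G θ lam) ∧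
      ∀ N, secondOrder lam a N
        = g N * ((2 * Real.pi) ^ lam * (2 * zetaReal (-lam))) + d N := by
  set c := (2 * Real.pi) ^ lam * (2 * zetaReal (-lam)) with hc
  choose p n hn hs using exists_binSum_eq
  refine ⟨fun N => G (binVec (n N)) lam,
    fun N => secondOrder lam a N - G (binVec (n N)) lam * c, ?_, fun N hN => ?_, fun N => by ring⟩
  · rw [Metric.tendsto_atTop]
    intro ε hε
    obtain ⟨N₀, hN₀⟩ := exists_abs_secondOrder_sub_le h0 h1 ha (tendsto_dyadicRemainder h0 h1)
      (half_pos hε)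
    refine ⟨N₀, fun N hN => ?_⟩
    rw [Real.dist_eq, sub_zero]
    have := hN₀ (p N) (n N) (hn N) (by rwa [hs])
    rw [hs] at this
    exact this.trans_lt (half_lt_self hε)
  -- Generalizing the length to a variable `q` permits the case split that is unavailable on `p N`.
  · have key : ∀ {q : ℕ} (m : Fin q → ℕ), StrictAnti m → 0 < binSum m →
        1 ≤ G (binVec m) lam ∧ ∃ p : ℕ, 1 ≤ p ∧ ∃ θ ∈ Theta p, G (binVec m) lam = G θ lam := by
      intro q m hm hpos
      obtain _ | q := q
      · simp [binSum] at hpos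
      · exact ⟨one_le_G_binVec h0 h1 hm, q + 1, by omega, _, binVec_mem_Theta hm, rfl⟩
    exact key (n N) (hn N) (by rwa [hs])

end GreedyCircle
end

/-! ### Conclusion from the range of `G` and the sign of the constant -/

theorem theorem3p14 (lam : ℝ) (hlam0 : 0 < lam) (hlam1 : lam < 1)
    (a : ℕ → Circle) (ha : IsGreedy lam a) :
    -- the sequence is bounded
    (∃ C : ℝ, ∀ N : ℕ, 2 ≤ N → |secondOrder lam a N| ≤ C) ∧
    -- and divergent
    (¬ ∃ l : ℝ, Tendsto (secondOrder lam a) atTop (𝓝 l)) ∧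
    -- the upper limit
    limsup (secondOrder lam a) atTop = (2 * Real.pi) ^ lam * (2 * zetaReal (-lam)) ∧
    -- the supremum defining `gBar lam` is finite, so that it is a genuine supremum
    IsLUB {x : ℝ | ∃ p : ℕ, 1 ≤ p ∧ ∃ θ ∈ Theta p, x = G θ lam} (gBar lam) ∧
    -- the lower limit
    liminf (secondOrder lam a) atTop =
      gBar lam * ((2 * Real.pi) ^ lam * (2 * zetaReal (-lam))) ∧
    -- limit points
    (∀ p : ℕ, 1 ≤ p → ∀ θ ∈ Theta p, ∃ φ : ℕ → ℕ, StrictMono φ ∧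
      Tendsto (fun m => secondOrder lam a (φ m)) atTop
        (𝓝 (G θ lam * ((2 * Real.pi) ^ lam * (2 * zetaReal (-lam)))))) := by
  have hlub := isLUB_gBar hlam0 hlam1
  have hpt := fun {p : ℕ} {θ : Fin p → ℝ} (hθ : θ ∈ Theta p) =>
    ha.exists_tendsto_secondOrder hlam0 hlam1 hθ
  obtain ⟨g, d, hd, hg, hu⟩ := ha.exists_secondOrder_eq hlam0 hlam1
  have hc := two_pi_rpow_mul_zetaReal_neg hlam0 hlam1
  set c := (2 * Real.pi) ^ lam * (2 * zetaReal (-lam))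
  set u := secondOrder lam a
  obtain ⟨θ₁, hθ₁, hG₁⟩ := exists_mem_Theta_G_eq_one lam
  obtain ⟨θ₂, hθ₂, hG₂⟩ := exists_mem_Theta_one_lt_G hlam0 hlam1
  have hg1 : ∀ N, 0 < N → 1 ≤ g N := fun N hN => (hg N hN).1
  have hg2 : ∀ N, 0 < N → g N ≤ gBar lam := fun N hN => hlub.1 (hg N hN).2
  have hbdd : ∃ C, ∀ N, |u N| ≤ C := by
    obtain ⟨D, hD⟩ := (Metric.isBounded_range_of_tendsto d hd).exists_norm_le
    -- The bounds on `g` hold only for `N > 0`, so the value at `0` enters separately.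
    refine ⟨max |u 0| (gBar lam * |c| + D), fun N => ?_⟩
    rcases Nat.eq_zero_or_pos N with rfl | hN
    · exact le_max_left _ _
    refine le_trans ?_ (le_max_right _ _)
    have h1 := hg1 N hN
    have h2 := hg2 N hN
    have h3 : |d N| ≤ D := hD _ (Set.mem_range_self N)
    rw [hu N]
    refine (abs_add_le _ _).trans (add_le_add ?_ h3)
    rw [abs_mul, abs_of_nonneg (by linarith)]
    exact mul_le_mul_of_nonneg_right h2 (abs_nonneg c)
  refine ⟨?_, ?_, ?_, hlub, ?_, fun p _ θ hθ => hpt hθ⟩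
  · obtain ⟨C, hC⟩ := hbdd
    exact ⟨C, fun N _ => hC N⟩
  · rintro ⟨l, hl⟩
    obtain ⟨φ, hφ, h1⟩ := hpt hθ₁
    obtain ⟨ψ, hψ, h2⟩ := hpt hθ₂
    have e1 := tendsto_nhds_unique h1 (hl.comp hφ.tendsto_atTop)
    have e2 := tendsto_nhds_unique h2 (hl.comp hψ.tendsto_atTop)
    rw [hG₁] at e1
    nlinarith
  · obtain ⟨φ, hφ, h1⟩ := hpt hθ₁
    rw [hG₁, one_mul] at h1
    refine limsup_eq_of_le_add_of_tendsto_comp hbdd hd ?_ hφ h1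
    filter_upwards [eventually_gt_atTop 0] with N hN
    rw [hu N]
    nlinarith [hg1 N hN]
  · refine liminf_eq_of_add_le_of_tendsto_comp hbdd hd ?_ fun ε hε => ?_
    · filter_upwards [eventually_gt_atTop 0] with N hN
      rw [hu N]
      nlinarith [hg2 N hN]
    -- A value of `G` within `ε / -c` of the supremum becomes, after multiplication by `c < 0`, a
    -- limit point below `gBar lam * c + ε`.
    · obtain ⟨x, ⟨p, hp, θ, hθ, rfl⟩, hlt, -⟩ :=
        hlub.exists_between (show gBar lam - ε / -c < gBar lam from
          sub_lt_self _ (div_pos hε (neg_pos.mpr hc)))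
      obtain ⟨φ, hφ, h1⟩ := hpt hθ
      refine ⟨_, φ, ?_, hφ, h1⟩
      have h2 := mul_lt_mul_of_neg_right hlt hc
      have h3 : (gBar lam - ε / -c) * c = gBar lam * c + ε := by
        rw [div_neg, sub_neg_eq_add, add_mul, div_mul_cancel₀ _ hc.ne]
      rwa [h3] at h2
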